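/- Quantum-secure pseudorandom functions are quantum universally unforgeable (qGUU). Setting. Let $\lambda$ be the security parameter and let $n,m:\mathbb N\to\mathbb N$ be polynomially bounded with $2^{-n(\lambda)}$ and $2^{-m(\lambda)}$ negligible, where $g\ge 0$ is *negligible* if for every $c$, $g(\lambda)\le\lambda^{-c}$ for all large $\lambda$. Let $F=\{F_k:\{0,1\}^{n(\lambda)}\to\{0,1\}^{m(\lambda)}\}_{k\in\mathcal K_\lambda}$ be a keyed family with finite non-empty key sets. A *QPT oracle algorithm* is a uniform polynomial-time family of quantum circuits: a single classical program which, given $\lambda,n(\lambda),m(\lambda)$, writes in time polynomial in $\lambda$ a circuit over the gates H, T, NOT, CNOT, Toffoli and oracle queries $|x,y\rangle\mapsto|x,y\oplus f(x)\rangle$, which is run on the all-zero state of qubits and measured at the end. $F$ is a *quantum-secure PRF* if for every QPT oracle algorithm $\mathcal A$ the quantity $$\Bigl|\Pr_{k\leftarrow\mathcal K_\lambda}[\mathcal A^{F_k}(1^\lambda)=1]-\Pr_{f}[\mathcal A^{f}(1^\lambda)=1]\Bigr|$$ is negligible, where $k$ is uniform in $\mathcal K_\lambda$ and $f$ is a uniformly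 random function $\{0,1\}^{n(\lambda)}\to\{0,1\}^{m(\lambda)}$. *qGUU game* for the deterministic classical primitive defined by $F$: (1) setup: the challenger draws $k\leftarrow\mathcal K_\lambda$ uniformly; (2) learning phase: the QPT adversary makes polynomially many quantum queries to the oracle $|x,y\rangle\mapsto|x,y\oplus F_k(x)\rangle$ (possibly entangled with its internal qubits); (3) challenge phase: the challenger draws $x\leftarrow\{0,1\}^{n(\lambda)}$ uniformly and sends it to the adversary; (4) guess phase: the adversary, continuing on its quantum state with no further queries, outputs $t\in\{0,1\}^{m(\lambda)}$ and wins iff $t=F_k(x)$. The primitive is *qGUU secure* if every QPT adversary's winning probability is negligible. Theorem. If $F$ is a quantum-secure PRF, then the primitive defined by $F$ (uniformly random key, evaluation $F_k$, verification $t=F_k(x)$) is qGUU secure. -/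

import Mathlib

namespace QUnforge

/-! ## Quantum circuits with oracle gates -/

/-- Bit strings of length `n`. -/
abbrev Bits (n : ℕ) : Type := Fin n → Bool

/-- A qubit is named by a register number and a position in that register. -/
abbrev Wire : Type := ℕ × ℕ

/-- Elementary gates whose operands are taken from `W`: Hadamard, the `π/8` gate `T`, NOT,
controlled NOT, Toffoli, and an oracle query with message register `r` and answer register `s`. -/
inductive Gate (W : Type) : Type
  | had (w : W)
  | phaseT (w : W)
  | not (w : W)
  | cnot (c t : W)
  | toffoli (c d t : W)
  | query (r s : ℕ)

/-- Rename the operands of a gate. -/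
def Gate.map {V W : Type} (g : V → W) : Gate V → Gate W
  | .had w => .had (g w)
  | .phaseT w => .phaseT (g w)
  | .not w => .not (g w)
  | .cnot c t => .cnot (g c) (g t)
  | .toffoli c d t => .toffoli (g c) (g d) (g t)
  | .query r s => .query r s

/-- The gate is not an oracle query. -/
def Gate.QueryFree {W : Type} : Gate W → Prop
  | .query _ _ => False
  | _ => True

/-- A circuit is a sequence of gates, the first one being applied first. -/
abbrev Circuit : Type := List (Gate Wire)

/-- The circuit makes no oracle query. -/
def Circuit.QueryFree (C : Circuit) : Prop := ∀ g ∈ C, Gate.QueryFree g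

/-- Computational basis states: a value for every qubit. -/
abbrev Basis : Type := Wire → Bool

/-- (Finite) superpositions of computational basis states. -/
abbrev QState : Type := Basis →₀ ℂ

/-- The basis vector `|b⟩`. -/
noncomputable def ket (b : Basis) : QState := Finsupp.single b 1

/-- All qubits are in state `|0⟩`. -/
noncomputable def zeroState : QState := ket (fun _ => false)

/-- The first `n` bits of register `r`. -/
def readReg (n r : ℕ) (b : Basis) : Bits n := fun i => b (r, i)

/-- XOR the string `y` into the first `m` bits of register `s`. -/
def xorReg {m : ℕ} (s : ℕ) (y : Bits m) (b : Basis) : Basis := fun w =>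
  if h : w.1 = s ∧ w.2 < m then Bool.xor (b w) (y ⟨w.2, h.2⟩) else b w

/-- The action of a gate on a basis state, the oracle being the standard oracle
`|x, y⟩ ↦ |x, y ⊕ f x⟩` of `f`. A gate whose target is also one of its controls, or a query
whose two registers coincide, acts as the identity. -/
noncomputable def Gate.onBasis {n m : ℕ} (f : Bits n → Bits m) : Gate Wire → Basis → QState
  | .had w, b => ((Real.sqrt 2 : ℝ) : ℂ)⁻¹ •
      (ket (Function.update b w false) +
        (if b w then (-1 : ℂ) else 1) • ket (Function.update b w true))
  | .phaseT w, b => (if b w then Complex.exp (Complex.I * Real.pi / 4) else 1) • ket b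
  | .not w, b => ket (Function.update b w (!b w))
  | .cnot c t, b => ket (if c = t then b else Function.update b t (Bool.xor (b t) (b c)))
  | .toffoli c d t, b =>
      ket (if c = t ∨ d = t then b else Function.update b t (Bool.xor (b t) (b c && b d)))
  | .query r s, b => ket (if r = s then b else xorReg s (f (readReg n r b)) b)

/-- Linear extension of a map given on basis states. -/
noncomputable def extend (u : Basis → QState) : QState →ₗ[ℂ] QState :=
  Finsupp.linearCombination ℂ u

/-- Run a circuit with oracle `f` on a state. -/
noncomputable def Circuit.run {n m : ℕ} (f : Bits n → Bits m) (C : Circuit) (ψ : QState) :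
    QState :=
  C.foldl (fun φ g => extend (g.onBasis f) φ) ψ

/-- Probability that measuring all qubits in the computational basis gives an outcome in `E`. -/
noncomputable def measureProb (ψ : QState) (E : Basis → Bool) : ℝ :=
  ψ.sum fun b a => if E b then ‖a‖ ^ 2 else 0

/-! ## Classical programs that write circuits, with a step count -/

/-- Classical memory: countably many variables holding natural numbers. -/
abbrev Store : Type := ℕ → ℕ

/-- Programs of a random access machine with addition, truncated subtraction and halving, that
can in addition append a gate to an output circuit. An operand `(r, v)` of an emitted gate denotes
the qubit of register `r` whose position is the current value of variable `v`. -/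
inductive Prog : Type
  | const (x c : ℕ)
  | add (x y z : ℕ)
  | sub (x y z : ℕ)
  | half (x y : ℕ)
  | emit (g : Gate (ℕ × ℕ))
  | seq (p q : Prog)
  | ifz (x : ℕ) (p q : Prog)
  | while (x : ℕ) (p : Prog)

/-- `Runs p σ τ C t`: started with memory `σ`, the program `p` halts after `t` steps with memory
`τ`, having written the circuit `C`. Every instruction and every test costs one step. -/
inductive Runs : Prog → Store → Store → Circuit → ℕ → Prop
  | const (x c : ℕ) (σ : Store) : Runs (.const x c) σ (Function.update σ x c) [] 1
  | add (x y z : ℕ) (σ : Store) : Runs (.add x y z) σ (Function.update σ x (σ y + σ z)) [] 1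
  | sub (x y z : ℕ) (σ : Store) : Runs (.sub x y z) σ (Function.update σ x (σ y - σ z)) [] 1
  | half (x y : ℕ) (σ : Store) : Runs (.half x y) σ (Function.update σ x (σ y / 2)) [] 1
  | emit (g : Gate (ℕ × ℕ)) (σ : Store) :
      Runs (.emit g) σ σ [g.map fun a => (a.1, σ a.2)] 1
  | seq {p q : Prog} {σ τ υ : Store} {C D : Circuit} {s t : ℕ} :
      Runs p σ τ C s → Runs q τ υ D t → Runs (.seq p q) σ υ (C ++ D) (s + t)
  | ifz_zero {x : ℕ} {p q : Prog} {σ τ : Store} {C : Circuit} {t : ℕ} :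
      σ x = 0 → Runs p σ τ C t → Runs (.ifz x p q) σ τ C (t + 1)
  | ifz_pos {x : ℕ} {p q : Prog} {σ τ : Store} {C : Circuit} {t : ℕ} :
      σ x ≠ 0 → Runs q σ τ C t → Runs (.ifz x p q) σ τ C (t + 1)
  | while_stop {x : ℕ} {p : Prog} {σ : Store} : σ x = 0 → Runs (.while x p) σ σ [] 1
  | while_step {x : ℕ} {p : Prog} {σ τ υ : Store} {C D : Circuit} {s t : ℕ} :
      σ x ≠ 0 → Runs p σ τ C s → Runs (.while x p) τ υ D t →
        Runs (.while x p) σ υ (C ++ D) (s + t + 1)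

/-- Initial memory: variables `0`, `1`, `2` hold the security parameter, the message length and
the tag length; all others hold `0`. -/
def inputStore (lam n m : ℕ) : Store := fun v =>
  if v = 0 then lam else if v = 1 then n else if v = 2 then m else 0

/-- A quantum polynomial-time oracle algorithm, for oracles from `n lam` bits to `m lam` bits: a
family of circuits with oracle gates that is written by one program in a number of steps which is
polynomial in the security parameter (so the circuits are of polynomial size). -/
structure QPTAlgorithm (n m : ℕ → ℕ) where
  prog : Prog
  circuit : ℕ → Circuit
  polyTime : ∃ P : Polynomial ℕ, ∀ lam : ℕ, ∃ (τ : Store) (t : ℕ),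
    t ≤ P.eval lam ∧ Runs prog (inputStore lam (n lam) (m lam)) τ (circuit lam) t

/-! ## Negligible functions, expectations -/

/-- `f` is negligible: for every `c`, eventually `f lam ≤ 1 / lam ^ c`
(used for non-negative functions). -/
def Negligible (f : ℕ → ℝ) : Prop :=
  ∀ c : ℕ, ∀ᶠ lam : ℕ in Filter.atTop, f lam ≤ 1 / (lam : ℝ) ^ c

/-- Expectation of a bounded function under a discrete distribution. -/
noncomputable def expect {α : Type} (μ : PMF α) (P : α → ℝ) : ℝ := ∑' a, (μ a).toReal * P a

/-! ## Quantum-secure pseudorandom functions -/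

/-- A keyed family of functions from `n lam` bits to `m lam` bits with finite key spaces. -/
structure FunctionFamily (n m : ℕ → ℕ) where
  Key : ℕ → Type
  [fintypeKey : ∀ lam, Fintype (Key lam)]
  [nonemptyKey : ∀ lam, Nonempty (Key lam)]
  fn : ∀ lam, Key lam → Bits (n lam) → Bits (m lam)

attribute [instance] FunctionFamily.fintypeKey FunctionFamily.nonemptyKey

/-- The register in which the challenger places the challenge message. -/
def challengeReg : ℕ := 2

/-- The register in which algorithms leave their output. -/
def outputReg : ℕ := 3

/-- Probability that the algorithm, with oracle `f`, outputs `1` at security parameter `lam`. -/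
noncomputable def QPTAlgorithm.acceptProb {n m : ℕ → ℕ} (A : QPTAlgorithm n m) (lam : ℕ)
    (f : Bits (n lam) → Bits (m lam)) : ℝ :=
  measureProb ((A.circuit lam).run f zeroState) fun b => b (outputReg, 0)

/-- The family is a quantum-secure pseudorandom function: no quantum polynomial-time oracle
algorithm distinguishes a member with uniformly random key from a uniformly random function. -/
def FunctionFamily.IsQPRF {n m : ℕ → ℕ} (F : FunctionFamily n m) : Prop :=
  ∀ A : QPTAlgorithm n m, Negligible fun lam =>
    |expect (PMF.uniformOfFintype (F.Key lam)) (fun k => A.acceptProb lam (F.fn lam k)) -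
      expect (PMF.uniformOfFintype (Bits (n lam) → Bits (m lam))) (fun f => A.acceptProb lam f)|

/-! ## Universal unforgeability of classical primitives -/

/-- A (non-randomised) classical primitive with messages of `n lam` bits and tags of `m lam` bits:
a key-generation distribution, an evaluation function and a verification predicate. -/
structure Primitive (n m : ℕ → ℕ) where
  Key : ℕ → Type
  setup : ∀ lam, PMF (Key lam)
  eval : ∀ lam, Key lam → Bits (n lam) → Bits (m lam)
  verify : ∀ lam, Key lam → Bits (n lam) → Bits (m lam) → Bool

/-- The primitive given by a keyed family of functions: uniformly random key, tag `F_k(x)`, and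
verification by comparison with `F_k(x)`. -/
noncomputable def FunctionFamily.toPrimitive {n m : ℕ → ℕ} (F : FunctionFamily n m) :
    Primitive n m where
  Key := F.Key
  setup lam := PMF.uniformOfFintype (F.Key lam)
  eval := F.fn
  verify lam k x t := decide (F.fn lam k x = t)

/-- A quantum polynomial-time adversary in the universal unforgeability game: a learning phase,
which may query the evaluation oracle, and a guess phase without queries, which continues on the
same qubits. -/
structure UniAdversary (n m : ℕ → ℕ) where
  learn : QPTAlgorithm n m
  guess : QPTAlgorithm n m
  guess_queryFree : ∀ lam, (guess.circuit lam).QueryFree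

/-- Probability that the adversary wins with key `k` and challenge `x`: after the learning phase
with the standard oracle of the evaluation function, the challenger XORs `x` into the challenge
register (blank unless the adversary wrote to it), the adversary runs its guess phase, and the
measured content `t` of the output register is verified as a tag of `x`. -/
noncomputable def UniAdversary.winProbAt {n m : ℕ → ℕ} (A : UniAdversary n m)
    (F : Primitive n m) (lam : ℕ) (k : F.Key lam) (x : Bits (n lam)) : ℝ :=
  let learned := (A.learn.circuit lam).run (F.eval lam k) zeroState
  let challenged := extend (fun b => ket (xorReg challengeReg x b)) learned
  let final := (A.guess.circuit lam).run (F.eval lam k) challenged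
  measureProb final fun b => F.verify lam k x (readReg (m lam) outputReg b)

/-- Probability that the adversary wins the universal unforgeability game: the key is generated by
the setup, the challenge is a uniformly random message. -/
noncomputable def UniAdversary.winProb {n m : ℕ → ℕ} (A : UniAdversary n m)
    (F : Primitive n m) (lam : ℕ) : ℝ :=
  expect (F.setup lam) fun k =>
    expect (PMF.uniformOfFintype (Bits (n lam))) fun x => A.winProbAt F lam k x

/-- Quantum (generalised) universal unforgeability. -/
def Primitive.IsQGUU {n m : ℕ → ℕ} (F : Primitive n m) : Prop :=
  ∀ A : UniAdversary n m, Negligible fun lam => A.winProb F lam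

end QUnforge

/-! The proof is a reduction, followed by an information-theoretic bound for a truly random
function.

Reduction. A distinguisher plays the game with its own oracle `f` in the role of the secret
function. It runs the learning phase, puts a uniform superposition of `x` into a fresh register `B`,
XORs it into the challenge register, runs the guess phase, queries `f` at register `B` and compares
the answer with the guess. The guess phase never touches register `B`, so branches with different
`x` stay orthogonal and the acceptance probability is exactly the average over `x` of the success
probability (`measureProb_gameCircuit`). With `f = F_k` this is the winning probability in the game;
by PRF security it is negligibly close to its value for random `f`. The distinguisher must itself be
written by a single polynomial-time program, which is what `runs_gameProg` provides.

Random `f`. Replace the value at `x` by an independent `y`. A learning circuit of length `L` hardly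
notices: a hybrid argument bounds the squared errors, summed over all `x`, by `4 L ^ 2`
(`sum_normSq_run_sub_le`), since the query weights at different points add up to at most one per
gate. In the modified experiment the target `f x` is independent of everything the adversary saw, so
it is hit with probability `2 ^ (-m)`. Together this gives the bound `2 * 2 ^ (-m) + 8 * L ^ 2 * 2 ^
(-n)` (`sum_guessProb_le`), which is negligible. -/

namespace QUnforge

/-! ## Measurement probabilities and the squared norm -/

theorem measureProb_eq_sum {ψ : QState} {S : Finset Basis} (h : ψ.support ⊆ S)
    (E : Basis → Bool) :
    measureProb ψ E = ∑ b ∈ S, if E b then ‖ψ b‖ ^ 2 else 0 := by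
  unfold measureProb
  exact Finsupp.sum_of_support_subset ψ h _ (by simp)

/-- The squared norm of a superposition. -/
noncomputable def normSq (ψ : QState) : ℝ := measureProb ψ fun _ => true

theorem normSq_eq_sum {ψ : QState} {S : Finset Basis} (h : ψ.support ⊆ S) :
    normSq ψ = ∑ b ∈ S, ‖ψ b‖ ^ 2 := by
  simp [normSq, measureProb_eq_sum h]

theorem measureProb_nonneg (ψ : QState) (E : Basis → Bool) : 0 ≤ measureProb ψ E := by
  rw [measureProb_eq_sum subset_rfl]
  exact Finset.sum_nonneg fun b _ => by split_ifs <;> positivity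

theorem normSq_nonneg (ψ : QState) : 0 ≤ normSq ψ := measureProb_nonneg _ _

@[simp]
theorem measureProb_zero (E : Basis → Bool) : measureProb 0 E = 0 := by
  simp [measureProb]

@[simp]
theorem normSq_zero : normSq 0 = 0 := measureProb_zero _

theorem normSq_zeroState : normSq zeroState = 1 := by
  simp [normSq, measureProb, zeroState, ket, Finsupp.sum_single_index]

theorem measureProb_congr {ψ : QState} {E E' : Basis → Bool} (h : ∀ b ∈ ψ.support, E b = E' b) :
    measureProb ψ E = measureProb ψ E' := by
  rw [measureProb_eq_sum subset_rfl, measureProb_eq_sum subset_rfl]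
  exact Finset.sum_congr rfl fun b hb => by rw [h b hb]

theorem measureProb_le_normSq (ψ : QState) (E : Basis → Bool) : measureProb ψ E ≤ normSq ψ := by
  rw [measureProb_eq_sum subset_rfl, normSq_eq_sum subset_rfl]
  exact Finset.sum_le_sum fun b _ => by split_ifs <;> first | exact le_rfl | positivity

theorem measureProb_smul (c : ℂ) (ψ : QState) (E : Basis → Bool) :
    measureProb (c • ψ) E = ‖c‖ ^ 2 * measureProb ψ E := by
  rw [measureProb_eq_sum (Finsupp.support_smul (b := c) (g := ψ)),
    measureProb_eq_sum subset_rfl, Finset.mul_sum]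
  refine Finset.sum_congr rfl fun b _ => ?_
  split_ifs <;> simp [mul_pow]

theorem normSq_neg (ψ : QState) : normSq (-ψ) = normSq ψ := by
  have := measureProb_smul (-1) ψ fun _ => true
  simpa [normSq] using this

/-- The cross term is absorbed by `0 ≤ c⁻¹ * (c * ‖u‖ - ‖v‖) ^ 2`. The weight `c` stays free because
the hybrid argument tunes it to the circuit length; a fixed weight would give exponential growth. -/
theorem norm_add_sq_le_weighted (u v : ℂ) {c : ℝ} (hc : 0 < c) :
    ‖u + v‖ ^ 2 ≤ (1 + c) * ‖u‖ ^ 2 + (1 + c⁻¹) * ‖v‖ ^ 2 := by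
  have h1 : ‖u + v‖ ^ 2 ≤ (‖u‖ + ‖v‖) ^ 2 := by gcongr; exact norm_add_le u v
  have h2 : 0 ≤ c⁻¹ * (c * ‖u‖ - ‖v‖) ^ 2 := by positivity
  have h3 : c⁻¹ * (c * ‖u‖ - ‖v‖) ^ 2 = c * ‖u‖ ^ 2 - 2 * ‖u‖ * ‖v‖ + c⁻¹ * ‖v‖ ^ 2 := by
    field_simp
    ring
  linarith

theorem measureProb_add_le (ψ φ : QState) (E : Basis → Bool) {c : ℝ} (hc : 0 < c) :
    measureProb (ψ + φ) E ≤ (1 + c) * measureProb ψ E + (1 + c⁻¹) * measureProb φ E := by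
  classical
  rw [measureProb_eq_sum (Finsupp.support_add (g₁ := ψ) (g₂ := φ)),
    measureProb_eq_sum (ψ := ψ) (Finset.subset_union_left (s₂ := φ.support)),
    measureProb_eq_sum (ψ := φ) (Finset.subset_union_right (s₁ := ψ.support)),
    Finset.mul_sum, Finset.mul_sum, ← Finset.sum_add_distrib]
  refine Finset.sum_le_sum fun b _ => ?_
  split_ifs
  · exact norm_add_sq_le_weighted _ _ hc
  · simp

theorem normSq_sub_le (ψ φ : QState) : normSq (ψ - φ) ≤ 2 * normSq ψ + 2 * normSq φ := by
  have h := measureProb_add_le ψ (-φ) (fun _ => true) one_pos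
  have h2 := normSq_neg φ
  unfold normSq at *
  rw [h2] at h
  rw [sub_eq_add_neg]
  norm_num at h
  exact h

/-- Every basis state lies in exactly one fibre of `g`. It serves twice: for the weights of the
query points, and for the probabilities of the possible guesses. -/
theorem sum_measureProb_fiber {Y : Type} [Fintype Y] [DecidableEq Y] (ψ : QState)
    (g : Basis → Y) : ∑ y, measureProb ψ (fun b => decide (y = g b)) = normSq ψ := by
  simp_rw [measureProb_eq_sum (ψ := ψ) subset_rfl, normSq_eq_sum (ψ := ψ) subset_rfl]
  rw [Finset.sum_comm]
  refine Finset.sum_congr rfl fun b _ => ?_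
  simp

theorem normSq_filter (ψ : QState) (E : Basis → Bool) :
    normSq (ψ.filter fun b => E b = true) = measureProb ψ E := by
  classical
  have hs : (ψ.filter fun b => E b = true).support ⊆ ψ.support := by
    rw [Finsupp.support_filter]
    exact Finset.filter_subset _ _
  rw [normSq_eq_sum hs, measureProb_eq_sum subset_rfl]
  refine Finset.sum_congr rfl fun b _ => ?_
  by_cases h : E b = true <;> simp [h]

/-- Orthogonality of superpositions that carry different labels. -/
theorem measureProb_sum_of_label {X : Type} [Fintype X] (v : X → QState) (label : Basis → X)
    (h : ∀ x, ∀ b ∈ (v x).support, label b = x) (E : Basis → Bool) :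
    measureProb (∑ x, v x) E = ∑ x, measureProb (v x) E := by
  classical
  let S : Finset Basis := Finset.univ.biUnion fun x => (v x).support
  have hS : ∀ x, (v x).support ⊆ S := fun x => Finset.subset_biUnion_of_mem (fun x => (v x).support) (Finset.mem_univ x)
  have hsum : (∑ x, v x).support ⊆ S := Finsupp.support_finsetSum
  rw [measureProb_eq_sum hsum, Finset.sum_congr rfl fun x _ => measureProb_eq_sum (hS x) E,
    Finset.sum_comm]
  refine Finset.sum_congr rfl fun b _ => ?_
  have h0 : ∀ x, x ≠ label b → v x b = 0 := fun x hx => by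
    by_contra hne
    exact hx (h x b (Finsupp.mem_support_iff.2 hne)).symm
  rw [Finsupp.finsetSum_apply, Finset.sum_eq_single (label b) (fun x _ hx => h0 x hx) (by simp),
    Finset.sum_eq_single (label b) (fun x _ hx => by simp [h0 x hx]) (by simp)]

/-! ## Linear extension of maps on basis states -/

@[simp]
theorem extend_ket (u : Basis → QState) (b : Basis) : extend u (ket b) = u b := by
  simp [extend, ket]

theorem extend_eq_sum (u : Basis → QState) (ψ : QState) :
    extend u ψ = ψ.sum fun b a => a • u b := by
  simp [extend, Finsupp.linearCombination_apply]

theorem linearMap_ext_ket {u v : QState →ₗ[ℂ] QState} (h : ∀ b, u (ket b) = v (ket b)) :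
    u = v := by
  refine Finsupp.lhom_ext fun b a => ?_
  have : (Finsupp.single b a : QState) = a • ket b := by simp [ket]
  rw [this, map_smul, map_smul, h]

theorem extend_congr {u v : Basis → QState} {ψ : QState} (h : ∀ b ∈ ψ.support, u b = v b) :
    extend u ψ = extend v ψ := by
  rw [extend_eq_sum, extend_eq_sum]
  exact Finset.sum_congr rfl fun b hb => by simp only [h b hb]

/-- Linear extension of a classical map on basis states. -/
noncomputable def permute (p : Basis → Basis) : QState →ₗ[ℂ] QState := extend fun b => ket (p b)

@[simp]
theorem permute_ket (p : Basis → Basis) (b : Basis) : permute p (ket b) = ket (p b) := by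
  simp [permute]

theorem permute_eq_mapDomain (p : Basis → Basis) (ψ : QState) :
    permute p ψ = Finsupp.mapDomain p ψ := by
  rw [permute, extend_eq_sum, Finsupp.mapDomain]
  simp [ket]

theorem permute_permute (p q : Basis → Basis) (ψ : QState) :
    permute p (permute q ψ) = permute (fun b => p (q b)) ψ := by
  have : permute p ∘ₗ permute q = permute fun b => p (q b) := linearMap_ext_ket fun b => by simp
  exact LinearMap.congr_fun this ψ

theorem measureProb_permute {p : Basis → Basis} (hp : Function.Injective p) (ψ : QState)
    (E : Basis → Bool) : measureProb (permute p ψ) E = measureProb ψ fun b => E (p b) := by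
  rw [permute_eq_mapDomain, measureProb, Finsupp.sum_mapDomain_index_inj hp]
  rfl

theorem normSq_permute {p : Basis → Basis} (hp : Function.Injective p) (ψ : QState) :
    normSq (permute p ψ) = normSq ψ := measureProb_permute hp ψ _

theorem mem_support_permute {p : Basis → Basis} {ψ : QState} {b : Basis}
    (h : b ∈ (permute p ψ).support) : ∃ b' ∈ ψ.support, p b' = b := by
  classical
  rw [permute_eq_mapDomain] at h
  simpa using Finsupp.mapDomain_support h

/-! ## Gates that permute basis states -/

section gates

variable {n m : ℕ} (f : Bits n → Bits m)

/-- The gate permutes the computational basis. -/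
def Gate.Classical {W : Type} : Gate W → Prop
  | .had _ => False
  | .phaseT _ => False
  | _ => True

/-- The permutation of the basis states made by a classical gate. -/
def Gate.act : Gate Wire → Basis → Basis
  | .had _, b => b
  | .phaseT _, b => b
  | .not w, b => Function.update b w (!b w)
  | .cnot c t, b => if c = t then b else Function.update b t (Bool.xor (b t) (b c))
  | .toffoli c d t, b =>
      if c = t ∨ d = t then b else Function.update b t (Bool.xor (b t) (b c && b d))
  | .query r s, b => if r = s then b else xorReg s (f (readReg n r b)) b

theorem xorReg_of_ne {s : ℕ} {y : Bits m} {b : Basis} {w : Wire} (h : w.1 ≠ s) :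
    xorReg s y b w = b w := by
  simp [xorReg, h]

theorem xorReg_xorReg (s : ℕ) (y : Bits m) (b : Basis) : xorReg s y (xorReg s y b) = b := by
  funext w
  unfold xorReg
  split_ifs <;> simp

theorem xorReg_injective (s : ℕ) (y : Bits m) : Function.Injective (xorReg s y) :=
  Function.Involutive.injective (xorReg_xorReg s y)

theorem readReg_xorReg_of_ne {r s : ℕ} (h : r ≠ s) (y : Bits m) (b : Basis) :
    readReg n r (xorReg s y b) = readReg n r b := by
  funext i
  exact xorReg_of_ne h

/-- A gate XORs into its target something that does not depend on the target, so a second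
application cancels the first. The convention that degenerate gates act as the identity secures this
independence. -/
theorem Gate.act_involutive (g : Gate Wire) : Function.Involutive (g.act f) := by
  intro b
  cases g with
  | had w => rfl
  | phaseT w => rfl
  | not w => simp [Gate.act]
  | cnot c t =>
    by_cases h : c = t
    · simp [Gate.act, h]
    · simp [Gate.act, h]
  | toffoli c d t =>
    by_cases h : c = t ∨ d = t
    · simp [Gate.act, h]
    · have h' := not_or.1 h
      simp [Gate.act, h'.1, h'.2]
  | query r s =>
    by_cases h : r = s
    · simp [Gate.act, h]
    · simp [Gate.act, h, readReg_xorReg_of_ne h, xorReg_xorReg]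

theorem Gate.onBasis_of_classical {g : Gate Wire} (hg : g.Classical) (b : Basis) :
    g.onBasis f b = ket (g.act f b) := by
  cases g with
  | had w => exact hg.elim
  | phaseT w => exact hg.elim
  | _ => simp only [Gate.onBasis, Gate.act]

/-! ## Gates are isometries -/

theorem ket_apply [DecidableEq Basis] (b b' : Basis) : ket b b' = if b = b' then 1 else 0 := by
  simp [ket, Finsupp.single_apply]

theorem extend_phaseT_apply (w : Wire) (ψ : QState) (b : Basis) :
    extend ((Gate.phaseT w).onBasis f) ψ b =
      (if b w then Complex.exp (Complex.I * Real.pi / 4) else 1) * ψ b := by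
  classical
  rw [extend_eq_sum, Finsupp.sum_apply, Finsupp.sum, Finset.sum_eq_single b]
  · simp only [Gate.onBasis, Finsupp.smul_apply, smul_eq_mul, ket_apply, if_true]
    ring
  · intro c _ hc
    simp only [Gate.onBasis, Finsupp.smul_apply, smul_eq_mul, ket_apply, hc, if_false, mul_zero]
  · intro h
    simp [Finsupp.notMem_support_iff.1 h]

theorem norm_phase (c : Bool) :
    ‖(if c then Complex.exp (Complex.I * Real.pi / 4) else 1 : ℂ)‖ = 1 := by
  cases c
  · simp
  · have : Complex.I * Real.pi / 4 = ((Real.pi / 4 : ℝ) : ℂ) * Complex.I := by push_cast; ring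
    simp only [if_true, this, Complex.norm_exp_ofReal_mul_I]

theorem normSq_phaseT (w : Wire) (ψ : QState) :
    normSq (extend ((Gate.phaseT w).onBasis f) ψ) = normSq ψ := by
  have hs : (extend ((Gate.phaseT w).onBasis f) ψ).support ⊆ ψ.support := by
    intro b hb
    rw [Finsupp.mem_support_iff, extend_phaseT_apply] at hb
    exact Finsupp.mem_support_iff.2 (right_ne_zero_of_mul hb)
  rw [normSq_eq_sum hs, normSq_eq_sum subset_rfl]
  refine Finset.sum_congr rfl fun b _ => ?_
  rw [extend_phaseT_apply, norm_mul, norm_phase, one_mul]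

/-- Flip one bit. -/
def flipBit (w : Wire) (b : Basis) : Basis := Function.update b w (!b w)

theorem flipBit_involutive (w : Wire) : Function.Involutive (flipBit w) := fun b => by
  simp [flipBit]

theorem extend_had_apply (w : Wire) (ψ : QState) (b : Basis) :
    extend ((Gate.had w).onBasis f) ψ b = ((Real.sqrt 2 : ℝ) : ℂ)⁻¹ *
      (ψ (flipBit w b) + (if b w then (-1 : ℂ) else 1) * ψ b) := by
  classical
  have key : ∀ c : Basis, (Gate.had w).onBasis f c b = ((Real.sqrt 2 : ℝ) : ℂ)⁻¹ *
      (ket c (flipBit w b) + (if b w then (-1 : ℂ) else 1) * ket c b) := by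
    intro c
    simp only [Gate.onBasis, Finsupp.smul_apply, Finsupp.add_apply, smul_eq_mul]
    congr 1
    -- Only `b` and its flip at `w` are mapped by the Hadamard gate to something with a `b`
    -- component.
    have h1 : ∀ v : Bool, Function.update c w v = b ↔ (b w = v ∧ (c = b ∨ c = flipBit w b)) := by
      intro v
      constructor
      · rintro rfl
        refine ⟨by simp, ?_⟩
        by_cases hv : c w = v
        · left; rw [← hv]; simp
        · right
          funext u
          by_cases hu : u = w
          · subst hu; cases h : c u <;> cases v <;> simp_all [flipBit]
          · simp [flipBit, hu]
      · rintro ⟨rfl, rfl | rfl⟩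
        · simp
        · simp [flipBit]
    have h2 : ¬ (c = b ∧ c = flipBit w b) := by
      rintro ⟨rfl, h⟩
      have := congrFun h w
      simp [flipBit] at this
    simp only [ket_apply, h1]
    by_cases hb : c = b
    · subst hb
      have : c ≠ flipBit w c := fun h => h2 ⟨rfl, h⟩
      cases h : c w <;> simp [this]
    · by_cases hf : c = flipBit w b
      · have h3 : c w = !b w := by rw [hf]; simp [flipBit]
        cases h : b w <;> simp [hb, ← hf, h3, h]
      · simp [hb, hf]
  have hlin : ∀ c, (Finsupp.lapply b ∘ₗ extend ((Gate.had w).onBasis f)) (ket c) =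
      (((Real.sqrt 2 : ℝ) : ℂ)⁻¹ • ((Finsupp.lapply (flipBit w b) : QState →ₗ[ℂ] ℂ) +
        (if b w then (-1 : ℂ) else 1) • (Finsupp.lapply b : QState →ₗ[ℂ] ℂ))) (ket c) := by
    intro c
    simp only [LinearMap.comp_apply, extend_ket, LinearMap.smul_apply, LinearMap.add_apply,
      Finsupp.lapply_apply, smul_eq_mul]
    exact key c
  have hl : (Finsupp.lapply b ∘ₗ extend ((Gate.had w).onBasis f)) =
      (((Real.sqrt 2 : ℝ) : ℂ)⁻¹ • ((Finsupp.lapply (flipBit w b) : QState →ₗ[ℂ] ℂ) +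
        (if b w then (-1 : ℂ) else 1) • (Finsupp.lapply b : QState →ₗ[ℂ] ℂ))) := by
    refine Finsupp.lhom_ext fun c a => ?_
    have : (Finsupp.single c a : QState) = a • ket c := by simp [ket]
    rw [this, map_smul, map_smul, hlin]
  have h := LinearMap.congr_fun hl ψ
  simp only [LinearMap.comp_apply, LinearMap.smul_apply, LinearMap.add_apply,
    Finsupp.lapply_apply, smul_eq_mul] at h
  exact h

theorem norm_sqrt_two_inv_sq : ‖((Real.sqrt 2 : ℝ) : ℂ)⁻¹‖ ^ 2 = 1 / 2 := by
  rw [norm_inv, Complex.norm_real, Real.norm_of_nonneg (Real.sqrt_nonneg 2), inv_pow,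
    Real.sq_sqrt (by norm_num)]
  norm_num

/-- On each pair `b`, `flipBit w b` the gate preserves the squared norm by the parallelogram law.
Summing over a finite set closed under the flip counts every pair twice on both sides. -/
theorem normSq_had (w : Wire) (ψ : QState) :
    normSq (extend ((Gate.had w).onBasis f) ψ) = normSq ψ := by
  classical
  set H := extend ((Gate.had w).onBasis f) ψ with hH
  let S : Finset Basis := ψ.support ∪ ψ.support.image (flipBit w)
  have hflip : ∀ b, b ∈ S → flipBit w b ∈ S := by
    intro b hb
    rcases Finset.mem_union.1 hb with h | h
    · exact Finset.mem_union_right _ (Finset.mem_image_of_mem _ h)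
    · obtain ⟨c, hc, rfl⟩ := Finset.mem_image.1 h
      rw [flipBit_involutive w c]
      exact Finset.mem_union_left _ hc
  have hHS : H.support ⊆ S := by
    intro b hb
    by_contra hn
    have h1 : ψ b = 0 := by
      by_contra h
      exact hn (Finset.mem_union_left _ (Finsupp.mem_support_iff.2 h))
    have h2 : ψ (flipBit w b) = 0 := by
      by_contra h
      refine hn (Finset.mem_union_right _ (Finset.mem_image.2
        ⟨_, Finsupp.mem_support_iff.2 h, flipBit_involutive w b⟩))
    rw [Finsupp.mem_support_iff, hH, extend_had_apply, h1, h2] at hb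
    simp at hb
  have hreindex : ∀ F : Basis → ℝ, ∑ b ∈ S, F (flipBit w b) = ∑ b ∈ S, F b := fun F =>
    Finset.sum_nbij' (flipBit w) (flipBit w) hflip hflip (fun b _ => flipBit_involutive w b)
      (fun b _ => flipBit_involutive w b) fun _ _ => rfl
  have hpt : ∀ b, ‖H b‖ ^ 2 + ‖H (flipBit w b)‖ ^ 2 = ‖ψ b‖ ^ 2 + ‖ψ (flipBit w b)‖ ^ 2 := by
    intro b
    have hpar := parallelogram_law_with_norm ℝ (ψ b) (ψ (flipBit w b))
    have hfw : flipBit w b w = !b w := by simp [flipBit]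
    rw [hH, extend_had_apply, extend_had_apply, flipBit_involutive w b, norm_mul, norm_mul,
      mul_pow, mul_pow, norm_sqrt_two_inv_sq, hfw]
    have hsub : ‖ψ (flipBit w b) - ψ b‖ = ‖ψ b - ψ (flipBit w b)‖ := norm_sub_rev _ _
    cases h : b w
    · simp only [Bool.not_false, if_true, if_false, one_mul, neg_mul, Bool.false_eq_true,
        ← sub_eq_add_neg, add_comm (ψ (flipBit w b)) (ψ b)]
      nlinarith
    · simp only [Bool.not_true, if_true, if_false, one_mul, neg_mul, Bool.false_eq_true,
        ← sub_eq_add_neg, hsub]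
      nlinarith
  rw [normSq_eq_sum hHS, normSq_eq_sum (ψ := ψ) (S := S) Finset.subset_union_left]
  have h := Finset.sum_congr (s₁ := S) rfl fun b _ => hpt b
  rw [Finset.sum_add_distrib, Finset.sum_add_distrib, hreindex fun b => ‖H b‖ ^ 2,
    hreindex fun b => ‖ψ b‖ ^ 2] at h
  linarith

theorem extend_onBasis_of_classical {g : Gate Wire} (hg : g.Classical) :
    extend (g.onBasis f) = permute (g.act f) :=
  congrArg extend (funext fun b => Gate.onBasis_of_classical f hg b)

theorem normSq_gate (g : Gate Wire) (ψ : QState) : normSq (extend (g.onBasis f) ψ) = normSq ψ := by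
  by_cases hg : g.Classical
  · rw [extend_onBasis_of_classical f hg, normSq_permute (g.act_involutive f).injective]
  · cases g with
    | had w => exact normSq_had f w ψ
    | phaseT w => exact normSq_phaseT f w ψ
    | _ => exact (hg trivial).elim

/-! ## Running circuits -/

/-- `Circuit.run` as a linear map. -/
noncomputable def Circuit.runLin (C : Circuit) : QState →ₗ[ℂ] QState :=
  C.foldr (fun g u => u ∘ₗ extend (g.onBasis f)) LinearMap.id

@[simp]
theorem Circuit.run_nil (ψ : QState) : Circuit.run f [] ψ = ψ := rfl

@[simp]
theorem Circuit.run_cons (g : Gate Wire) (C : Circuit) (ψ : QState) :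
    Circuit.run f (g :: C) ψ = Circuit.run f C (extend (g.onBasis f) ψ) := rfl

theorem Circuit.run_append (C D : Circuit) (ψ : QState) :
    Circuit.run f (C ++ D) ψ = Circuit.run f D (Circuit.run f C ψ) := by
  simp [Circuit.run]

theorem Circuit.runLin_apply (C : Circuit) (ψ : QState) :
    Circuit.runLin f C ψ = Circuit.run f C ψ := by
  induction C generalizing ψ with
  | nil => rfl
  | cons g C ih => rw [Circuit.run_cons, ← ih]; rfl

theorem Circuit.run_sub (C : Circuit) (ψ φ : QState) :
    Circuit.run f C (ψ - φ) = Circuit.run f C ψ - Circuit.run f C φ := by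
  simp only [← Circuit.runLin_apply, map_sub]

theorem normSq_run (C : Circuit) (ψ : QState) : normSq (Circuit.run f C ψ) = normSq ψ := by
  induction C generalizing ψ with
  | nil => rfl
  | cons g C ih => rw [Circuit.run_cons, ih, normSq_gate]

theorem Gate.onBasis_of_queryFree {g : Gate Wire} (hg : g.QueryFree) (f' : Bits n → Bits m) :
    g.onBasis f = g.onBasis f' := by
  cases g with
  | query r s => exact hg.elim
  | _ => funext b; simp only [Gate.onBasis]

/-- Makes it free of charge to change the oracle in the guess phase, so that only the learning phase
contributes an error. -/
theorem Circuit.run_of_queryFree {C : Circuit} (hC : C.QueryFree) (f' : Bits n → Bits m)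
    (ψ : QState) : Circuit.run f C ψ = Circuit.run f' C ψ := by
  induction C generalizing ψ with
  | nil => rw [Circuit.run_nil, Circuit.run_nil]
  | cons g C ih =>
    have hg : g.QueryFree := hC g List.mem_cons_self
    have hC' : Circuit.QueryFree C := fun g' h' => hC g' (List.mem_cons_of_mem g h')
    change Circuit.run f C (extend (g.onBasis f) ψ) = Circuit.run f' C (extend (g.onBasis f') ψ)
    rw [ih hC', Gate.onBasis_of_queryFree f hg f']

/-! ## Changing the oracle at one point -/

/-- Squared error made by one gate when the oracle is changed at the point `x`. -/
theorem sum_normSq_gate_sub_le (g : Gate Wire) (f' : Bits n → Bits n → Bits m)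
    (hf' : ∀ x z, z ≠ x → f' x z = f z) (ψ : QState) :
    ∑ x, normSq (extend (g.onBasis (f' x)) ψ - extend (g.onBasis f) ψ) ≤ 4 * normSq ψ := by
  classical
  have hsame : (∀ x, g.onBasis (f' x) = g.onBasis f) → ∑ x, normSq
      (extend (g.onBasis (f' x)) ψ - extend (g.onBasis f) ψ) ≤ 4 * normSq ψ := by
    intro h
    have := normSq_nonneg ψ
    simp only [h, sub_self, normSq_zero, Finset.sum_const_zero]
    linarith
  cases g with
  | query r s =>
    have hx : ∀ x, normSq (extend ((Gate.query r s).onBasis (f' x)) ψ -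
        extend ((Gate.query r s).onBasis f) ψ) ≤
          4 * measureProb ψ fun b => decide (x = readReg n r b) := by
      intro x
      set E : Basis → Bool := fun b => decide (x = readReg n r b) with hE
      -- Both oracles agree on the component that does not query `x`. The component that does is
      -- moved isometrically by each of them, so the difference costs at most `2 + 2 = 4` times its
      -- weight.
      have hrest : extend ((Gate.query r s).onBasis (f' x)) (ψ.filter fun b => ¬ E b = true) =
          extend ((Gate.query r s).onBasis f) (ψ.filter fun b => ¬ E b = true) := by
        refine extend_congr fun b hb => ?_
        have hb' : readReg n r b ≠ x := by
          rw [Finsupp.support_filter, Finset.mem_filter] at hb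
          simpa [hE, eq_comm] using hb.2
        simp only [Gate.onBasis, hf' x _ hb']
      have hsplit := Finsupp.filter_add_filter_not ψ fun b => E b = true
      have hle := normSq_sub_le
        (extend ((Gate.query r s).onBasis (f' x)) (ψ.filter fun b => E b = true))
        (extend ((Gate.query r s).onBasis f) (ψ.filter fun b => E b = true))
      rw [normSq_gate, normSq_gate, normSq_filter] at hle
      rw [← hsplit, map_add, map_add, hrest, add_sub_add_right_eq_sub, hsplit]
      linarith
    calc _ ≤ ∑ x, 4 * measureProb ψ fun b => decide (x = readReg n r b) :=
          Finset.sum_le_sum fun x _ => hx x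
      _ = 4 * normSq ψ := by rw [← Finset.mul_sum, sum_measureProb_fiber]
  | _ => exact hsame fun _ => funext fun b => by simp only [Gate.onBasis]

/-- A circuit rarely notices that the oracle has been changed at a random point. -/
theorem sum_normSq_run_sub_le (C : Circuit) (f' : Bits n → Bits n → Bits m)
    (hf' : ∀ x z, z ≠ x → f' x z = f z) (ψ : QState) :
    ∑ x, normSq (Circuit.run (f' x) C ψ - Circuit.run f C ψ) ≤
      4 * (C.length : ℝ) ^ 2 * normSq ψ := by
  induction C generalizing ψ with
  | nil => simp
  | cons g C ih =>
    set φ := extend (g.onBasis f) ψ with hφ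
    have hφn : normSq φ = normSq ψ := normSq_gate f g ψ
    have hN := normSq_nonneg ψ
    -- Hybrid step: the error of the first gate, carried along by the isometry of the tail, plus the
    -- error of the tail on the unmodified state `φ`.
    have hdec : ∀ x, Circuit.run (f' x) (g :: C) ψ - Circuit.run f (g :: C) ψ =
        Circuit.run (f' x) C (extend (g.onBasis (f' x)) ψ - φ) +
          (Circuit.run (f' x) C φ - Circuit.run f C φ) := by
      intro x
      rw [Circuit.run_cons, Circuit.run_cons, Circuit.run_sub, sub_add_sub_cancel]
    have hg := sum_normSq_gate_sub_le f g f' hf' ψ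
    have hC := ih φ
    rw [hφn] at hC
    -- The weight used below is the tail length, which must be positive.
    rcases Nat.eq_zero_or_pos C.length with h0 | hpos
    · have hnil : C = [] := List.length_eq_zero_iff.1 h0
      subst hnil
      simpa using hg
    · have hL : (0 : ℝ) < C.length := by exact_mod_cast hpos
      -- With weight `L = C.length` the induction closes exactly: `4 * (1 + L) + (1 + L⁻¹) * 4 * L ^
      -- 2 = 4 * (L + 1) ^ 2`.
      have hstep : ∀ x, normSq (Circuit.run (f' x) (g :: C) ψ - Circuit.run f (g :: C) ψ) ≤
          (1 + (C.length : ℝ)) * normSq (extend (g.onBasis (f' x)) ψ - φ) +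
            (1 + (C.length : ℝ)⁻¹) * normSq (Circuit.run (f' x) C φ - Circuit.run f C φ) := by
        intro x
        rw [hdec x]
        refine (measureProb_add_le _ _ _ hL).trans_eq ?_
        change _ * normSq _ + _ = _
        rw [normSq_run]
        rfl
      calc _ ≤ (1 + (C.length : ℝ)) * (4 * normSq ψ) +
              (1 + (C.length : ℝ)⁻¹) * (4 * (C.length : ℝ) ^ 2 * normSq ψ) := by
            refine (Finset.sum_le_sum fun x _ => hstep x).trans ?_
            rw [Finset.sum_add_distrib, ← Finset.mul_sum, ← Finset.mul_sum]
            gcongr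
        _ = 4 * ((g :: C).length : ℝ) ^ 2 * normSq ψ := by
            rw [List.length_cons]
            push_cast
            field_simp
            ring

end gates

/-! ## Circuits on the registers below a bound -/

/-- All operands of the gate lie in registers below `B`. -/
def Gate.RegsLt (B : ℕ) : Gate Wire → Prop
  | .had w => w.1 < B
  | .phaseT w => w.1 < B
  | .not w => w.1 < B
  | .cnot c t => c.1 < B ∧ t.1 < B
  | .toffoli c d t => c.1 < B ∧ d.1 < B ∧ t.1 < B
  | .query r s => r < B ∧ s < B

/-- All gates of the circuit act on registers below `B`. -/
def Circuit.RegsLt (B : ℕ) (C : Circuit) : Prop := ∀ g ∈ C, Gate.RegsLt B g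

/-- Basis states in which the registers from `B` on are blank. -/
def BlankFrom (B : ℕ) (b : Basis) : Prop := ∀ w : Wire, B ≤ w.1 → b w = false

/-- Superpositions of basis states in which the registers from `B` on are blank. -/
noncomputable def blankStates (B : ℕ) : Submodule ℂ QState :=
  Finsupp.supported ℂ ℂ {b | BlankFrom B b}

theorem mem_blankStates {B : ℕ} {ψ : QState} :
    ψ ∈ blankStates B ↔ ∀ b ∈ ψ.support, BlankFrom B b := by
  rw [blankStates, Finsupp.mem_supported]
  rfl

theorem ket_mem_blankStates {B : ℕ} {b : Basis} (hb : BlankFrom B b) : ket b ∈ blankStates B :=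
  Finsupp.single_mem_supported ℂ 1 hb

theorem extend_mem_blankStates {B : ℕ} {u : Basis → QState}
    (hu : ∀ b, BlankFrom B b → u b ∈ blankStates B) {ψ : QState} (hψ : ψ ∈ blankStates B) :
    extend u ψ ∈ blankStates B := by
  rw [extend_eq_sum]
  exact Submodule.sum_mem _ fun b hb =>
    Submodule.smul_mem _ _ (hu b (mem_blankStates.1 hψ b hb))

theorem linearMap_eq_of_mem_blankStates {B : ℕ} {u v : QState →ₗ[ℂ] QState}
    (h : ∀ b, BlankFrom B b → u (ket b) = v (ket b)) {ψ : QState} (hψ : ψ ∈ blankStates B) :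
    u ψ = v ψ := by
  rw [blankStates, Finsupp.supported_eq_span_single] at hψ
  refine LinearMap.eqOn_span (f := u) (g := v) ?_ hψ
  rintro _ ⟨b, hb, rfl⟩
  exact h b hb

theorem BlankFrom.update {B : ℕ} {b : Basis} (hb : BlankFrom B b) {w : Wire} (hw : w.1 < B)
    (v : Bool) : BlankFrom B (Function.update b w v) := by
  intro w' hw'
  have : w' ≠ w := by rintro rfl; omega
  rw [Function.update_of_ne this, hb w' hw']

theorem BlankFrom.xorReg {m B : ℕ} {b : Basis} (hb : BlankFrom B b) {s : ℕ} (hs : s < B)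
    (y : Bits m) : BlankFrom B (xorReg s y b) := by
  intro w hw
  rw [xorReg_of_ne (by omega), hb w hw]

section circuits

variable {n m k : ℕ} (f : Bits n → Bits m)

theorem Gate.onBasis_mem_blankStates {B : ℕ} {g : Gate Wire} (hg : g.RegsLt B) {b : Basis}
    (hb : BlankFrom B b) : g.onBasis f b ∈ blankStates B := by
  cases g with
  | had w =>
    exact Submodule.smul_mem _ _ (Submodule.add_mem _ (ket_mem_blankStates (hb.update hg _))
      (Submodule.smul_mem _ _ (ket_mem_blankStates (hb.update hg _))))
  | phaseT w => exact Submodule.smul_mem _ _ (ket_mem_blankStates hb)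
  | not w => exact ket_mem_blankStates (hb.update hg _)
  | cnot c t =>
    refine ket_mem_blankStates ?_
    split_ifs
    exacts [hb, hb.update hg.2 _]
  | toffoli c d t =>
    refine ket_mem_blankStates ?_
    split_ifs
    exacts [hb, hb.update hg.2.2 _]
  | query r s =>
    refine ket_mem_blankStates ?_
    split_ifs
    exacts [hb, hb.xorReg hg.2 _]

theorem Circuit.run_mem_blankStates {B : ℕ} {C : Circuit} (hC : C.RegsLt B) {ψ : QState}
    (hψ : ψ ∈ blankStates B) : Circuit.run f C ψ ∈ blankStates B := by
  induction C generalizing ψ with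
  | nil => exact hψ
  | cons g C ih =>
    exact ih (fun g' h' => hC g' (List.mem_cons_of_mem g h'))
      (extend_mem_blankStates (fun b hb =>
        Gate.onBasis_mem_blankStates f (hC g List.mem_cons_self) hb) hψ)

theorem zeroState_mem_blankStates (B : ℕ) : zeroState ∈ blankStates B :=
  ket_mem_blankStates fun _ _ => rfl

theorem permute_xorReg_mem_blankStates {B s : ℕ} (hs : s < B) (x : Bits k) {ψ : QState}
    (hψ : ψ ∈ blankStates B) : permute (xorReg s x) ψ ∈ blankStates B :=
  extend_mem_blankStates (fun _ hb => ket_mem_blankStates (hb.xorReg hs x)) hψ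

theorem update_xorReg {R : ℕ} (x : Bits k) {w : Wire} (hw : w.1 ≠ R) (b : Basis) (v : Bool) :
    Function.update (xorReg R x b) w v = xorReg R x (Function.update b w v) := by
  funext w'
  by_cases h : w' = w
  · subst h
    rw [xorReg_of_ne hw, Function.update_self, Function.update_self]
  · simp [xorReg, Function.update_of_ne h]

theorem xorReg_comm {R s : ℕ} (h : R ≠ s) (x : Bits k) (y : Bits m) (b : Basis) :
    xorReg s y (xorReg R x b) = xorReg R x (xorReg s y b) := by
  funext w
  by_cases hR : w.1 = R
  · rw [xorReg_of_ne (by omega)]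
    simp [xorReg, hR, h]
  · rw [xorReg_of_ne (s := R) hR]
    simp [xorReg, hR]

/-- Gates commute with operations on other registers. -/
theorem Gate.onBasis_xorReg {B R : ℕ} (hR : B ≤ R) {g : Gate Wire} (hg : g.RegsLt B)
    (x : Bits k) (b : Basis) :
    g.onBasis f (xorReg R x b) = permute (xorReg R x) (g.onBasis f b) := by
  have hne : ∀ {r : ℕ}, r < B → r ≠ R := fun h => by omega
  cases g with
  | had w =>
    simp only [Gate.onBasis, map_smul, map_add, permute_ket, update_xorReg x (hne hg),
      xorReg_of_ne (hne hg)]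
  | phaseT w => simp only [Gate.onBasis, map_smul, permute_ket, xorReg_of_ne (hne hg)]
  | not w =>
    simp only [Gate.onBasis, permute_ket, update_xorReg x (hne hg), xorReg_of_ne (hne hg)]
  | cnot c t =>
    simp only [Gate.onBasis, permute_ket, update_xorReg x (hne hg.2), xorReg_of_ne (hne hg.1),
      xorReg_of_ne (hne hg.2), apply_ite (xorReg R x)]
  | toffoli c d t =>
    simp only [Gate.onBasis, permute_ket, update_xorReg x (hne hg.2.2), xorReg_of_ne (hne hg.1),
      xorReg_of_ne (hne hg.2.1), xorReg_of_ne (hne hg.2.2), apply_ite (xorReg R x)]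
  | query r s =>
    simp only [Gate.onBasis, permute_ket, readReg_xorReg_of_ne (hne hg.1),
      xorReg_comm (hne hg.2).symm, apply_ite (xorReg R x)]

/-- Carries the challenge label unchanged through the guess phase. -/
theorem Circuit.run_permute_xorReg {B R : ℕ} (hR : B ≤ R) {C : Circuit} (hC : C.RegsLt B)
    (x : Bits k) (ψ : QState) :
    Circuit.run f C (permute (xorReg R x) ψ) = permute (xorReg R x) (Circuit.run f C ψ) := by
  induction C generalizing ψ with
  | nil => rw [Circuit.run_nil, Circuit.run_nil]
  | cons g C ih =>
    have hg : extend (g.onBasis f) ∘ₗ permute (xorReg R x) =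
        permute (xorReg R x) ∘ₗ extend (g.onBasis f) := by
      refine linearMap_ext_ket fun b => ?_
      rw [LinearMap.comp_apply, LinearMap.comp_apply, permute_ket, extend_ket, extend_ket,
        Gate.onBasis_xorReg f hR (hC g List.mem_cons_self)]
    rw [Circuit.run_cons, Circuit.run_cons,
      ← ih fun g' h' => hC g' (List.mem_cons_of_mem g h')]
    exact congrArg (Circuit.run f C) (LinearMap.congr_fun hg ψ)

/-! ## Preparing a random challenge -/

/-- Concatenation of the circuits `C (k - 1)`, …, `C 0`. -/
def countdown (C : ℕ → Circuit) : ℕ → Circuit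
  | 0 => []
  | k + 1 => C k ++ countdown C k

/-- Put a uniform superposition into register `R` and XOR it into the challenge register. -/
def prepareChallenge (R : ℕ) : ℕ → Circuit :=
  countdown fun i => [.had (R, i), .cnot (R, i) (challengeReg, i)]

/-- The preparation circuit treats qubit `k` first, which is the last bit of a string of length `k +
1`. This lemma and the next describe its two branches. -/
theorem xorReg_snoc_false (s : ℕ) (x : Bits k) (b : Basis) :
    xorReg s (Fin.snoc x false : Bits (k + 1)) b = xorReg s x b := by
  funext ⟨r, i⟩
  by_cases hr : r = s
  · rcases lt_trichotomy i k with hi | hi | hi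
    · have : (⟨i, by omega⟩ : Fin (k + 1)) = Fin.castSucc ⟨i, hi⟩ := rfl
      simp only [xorReg, hr, hi, Nat.lt_succ_of_lt hi, and_self, dif_pos, this, Fin.snoc_castSucc]
    · subst hi
      have : (⟨i, by omega⟩ : Fin (i + 1)) = Fin.last i := rfl
      simp [xorReg, this, Fin.snoc_last]
    · have h1 : ¬ i < k := by omega
      have h2 : ¬ i < k + 1 := by omega
      simp [xorReg, h1, h2]
  · rw [xorReg_of_ne (w := (r, i)) hr, xorReg_of_ne (w := (r, i)) hr]

theorem xorReg_snoc_true (s : ℕ) (x : Bits k) (b : Basis) :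
    xorReg s (Fin.snoc x true : Bits (k + 1)) b = xorReg s x (flipBit (s, k) b) := by
  funext ⟨r, i⟩
  by_cases hr : r = s
  · subst hr
    rcases lt_trichotomy i k with hi | hi | hi
    · have : (⟨i, by omega⟩ : Fin (k + 1)) = Fin.castSucc ⟨i, hi⟩ := rfl
      simp only [xorReg, hi, Nat.lt_succ_of_lt hi, and_self, dif_pos, this, Fin.snoc_castSucc]
      simp [flipBit, hi.ne]
    · subst hi
      have : (⟨i, by omega⟩ : Fin (i + 1)) = Fin.last i := rfl
      simp [xorReg, this, Fin.snoc_last, flipBit]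
    · have h1 : ¬ i < k := by omega
      have h2 : ¬ i < k + 1 := by omega
      simp [xorReg, h1, h2, flipBit, hi.ne']
  · rw [xorReg_of_ne (w := (r, i)) hr, xorReg_of_ne (w := (r, i)) hr]
    simp [flipBit, hr]

theorem flipBit_xorReg {R : ℕ} (x : Bits k) {w : Wire} (hw : w.1 ≠ R) (b : Basis) :
    flipBit w (xorReg R x b) = xorReg R x (flipBit w b) := by
  rw [flipBit, flipBit, xorReg_of_ne hw, update_xorReg x hw]

theorem sum_bits_succ {M : Type} [AddCommMonoid M] (F : Bits (k + 1) → M) :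
    ∑ x, F x = ∑ x : Bits k, (F (Fin.snoc x false) + F (Fin.snoc x true)) := by
  rw [← (Fin.snocEquiv fun _ : Fin (k + 1) => Bool).sum_comp, Fintype.sum_prod_type_right]
  refine Finset.sum_congr rfl fun x _ => ?_
  rw [Fintype.sum_bool, add_comm]
  rfl

/-- A Hadamard gate on a blank qubit opens two branches of equal amplitude, and the CNOT copies the
branch bit. Only register `R` has to be blank: the challenge register may hold anything, just as
when the challenger XORs `x` into it. -/
theorem run_prepareChallenge_ket {R : ℕ} (hR : R ≠ challengeReg) (b : Basis)
    (hb : ∀ i < k, b (R, i) = false) :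
    Circuit.run f (prepareChallenge R k) (ket b) = (((Real.sqrt 2 : ℝ) : ℂ)⁻¹) ^ k •
      ∑ x : Bits k, ket (xorReg R x (xorReg challengeReg x b)) := by
  induction k generalizing b with
  | zero =>
    have : ∀ (s : ℕ) (x : Bits 0) (b : Basis), xorReg s x b = b := by
      intro s x b
      funext w
      simp [xorReg]
    simp [prepareChallenge, countdown, this]
  | succ k ih =>
    have hbk : b (R, k) = false := hb k (Nat.lt_succ_self k)
    set b' := flipBit (challengeReg, k) (flipBit (R, k) b) with hb'
    have hne : ((R, k) : Wire) ≠ (challengeReg, k) := fun h => hR (congrArg Prod.fst h)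
    have h1 : extend ((Gate.had (R, k)).onBasis f) (ket b) =
        (((Real.sqrt 2 : ℝ) : ℂ)⁻¹) • (ket b + ket (flipBit (R, k) b)) := by
      have hup : Function.update b (R, k) false = b := by
        rw [← hbk, Function.update_eq_self]
      rw [extend_ket, Gate.onBasis, hbk, hup, if_neg Bool.false_ne_true, one_smul, flipBit, hbk,
        Bool.not_false]
    have h2 : extend ((Gate.cnot (R, k) (challengeReg, k)).onBasis f) (ket b) = ket b := by
      rw [extend_ket, Gate.onBasis, if_neg hne, hbk, Bool.xor_false, Function.update_eq_self]
    have h3 : extend ((Gate.cnot (R, k) (challengeReg, k)).onBasis f)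
        (ket (flipBit (R, k) b)) = ket b' := by
      have : flipBit (R, k) b (R, k) = true := by simp [flipBit, hbk]
      rw [extend_ket, Gate.onBasis, if_neg hne, this, Bool.xor_true]
      rfl
    have hrun : Circuit.run f (prepareChallenge R (k + 1)) (ket b) =
        (((Real.sqrt 2 : ℝ) : ℂ)⁻¹) • (Circuit.run f (prepareChallenge R k) (ket b) +
          Circuit.run f (prepareChallenge R k) (ket b')) := by
      change Circuit.run f (_ :: _ :: prepareChallenge R k) (ket b) = _
      rw [Circuit.run_cons, Circuit.run_cons, h1, map_smul, map_add, h2, h3]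
      simp only [← Circuit.runLin_apply, map_smul, map_add]
    have hblank : ∀ i < k, b' (R, i) = false := by
      intro i hi
      have hn1 : ((R, i) : Wire) ≠ (challengeReg, k) := fun h => hR (congrArg Prod.fst h)
      have hn2 : ((R, i) : Wire) ≠ (R, k) := fun h => hi.ne (congrArg Prod.snd h)
      rw [hb', flipBit, Function.update_of_ne hn1, flipBit, Function.update_of_ne hn2]
      exact hb i (by omega)
    rw [hrun, ih b fun i hi => hb i (by omega), ih b' hblank, ← smul_add, smul_smul, ← pow_succ',
      ← Finset.sum_add_distrib, sum_bits_succ]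
    congr 1
    refine Finset.sum_congr rfl fun x _ => ?_
    rw [xorReg_snoc_false, xorReg_snoc_false, xorReg_snoc_true, xorReg_snoc_true,
      flipBit_xorReg (w := (R, k)) x hR, hb']
    congr 4
    unfold flipBit
    rw [Function.update_of_ne hne, Function.update_of_ne hne.symm, Function.update_comm hne]

theorem run_prepareChallenge {B : ℕ} (hB : challengeReg < B) {ψ : QState}
    (hψ : ψ ∈ blankStates B) :
    Circuit.run f (prepareChallenge B k) ψ = (((Real.sqrt 2 : ℝ) : ℂ)⁻¹) ^ k •
      ∑ x : Bits k, permute (xorReg B x) (permute (xorReg challengeReg x) ψ) := by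
  have h := linearMap_eq_of_mem_blankStates (u := Circuit.runLin f (prepareChallenge B k))
    (v := (((Real.sqrt 2 : ℝ) : ℂ)⁻¹) ^ k •
      ∑ x : Bits k, permute (xorReg B x) ∘ₗ permute (xorReg challengeReg x)) ?_ hψ
  · rw [Circuit.runLin_apply] at h
    simpa [LinearMap.sum_apply] using h
  · intro b hb
    rw [Circuit.runLin_apply, run_prepareChallenge_ket f hB.ne' b fun i _ => hb (B, i) le_rfl]
    simp [LinearMap.sum_apply]

/-! ## Checking the guess -/

/-- The permutation of the basis states made by a classical circuit. -/
def Circuit.act (C : Circuit) (b : Basis) : Basis := C.foldl (fun b g => g.act f b) b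

theorem Circuit.act_append (C D : Circuit) (b : Basis) :
    Circuit.act f (C ++ D) b = Circuit.act f D (Circuit.act f C b) := by
  simp [Circuit.act]

theorem Circuit.act_injective (C : Circuit) : Function.Injective (Circuit.act f C) := by
  induction C with
  | nil => exact fun _ _ h => h
  | cons g C ih => exact fun b b' h => (g.act_involutive f).injective (ih h)

theorem Circuit.run_of_classical {C : Circuit} (hC : ∀ g ∈ C, Gate.Classical g) (ψ : QState) :
    Circuit.run f C ψ = permute (Circuit.act f C) ψ := by
  induction C generalizing ψ with
  | nil =>
    have : permute (Circuit.act f []) = LinearMap.id := linearMap_ext_ket fun b => by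
      rw [permute_ket]; rfl
    rw [this, Circuit.run_nil, LinearMap.id_apply]
  | cons g C ih =>
    rw [Circuit.run_cons, extend_onBasis_of_classical f (hC g List.mem_cons_self),
      ih fun g' h' => hC g' (List.mem_cons_of_mem g h'), permute_permute]
    rfl

/-- Accumulate in `(Q, 0)` whether the first bits of register `S` and of the output register
agree. -/
def compareRegs (S Q : ℕ) : ℕ → Circuit :=
  countdown fun i => [.cnot (S, i) (outputReg, i), .not (outputReg, i),
    .toffoli (outputReg, i) (Q, i + 1) (Q, i)]

/-- CNOT and NOT turn output bit `i` into the truth value of the equality at position `i`; the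
Toffoli gate writes its conjunction with `(Q, i + 1)` into the blank `(Q, i)`. A running conjunction
thus descends from `(Q, k)` to `(Q, 0)`. -/
theorem act_compareRegs {S Q : ℕ} (hSQ : S ≠ Q) (hS : S ≠ outputReg) (hQ : Q ≠ outputReg)
    (b : Basis) (hb : ∀ i < k, b (Q, i) = false) :
    (Circuit.act f (compareRegs S Q k) b (Q, 0) = true ↔
      b (Q, k) = true ∧ ∀ i < k, b (S, i) = b (outputReg, i)) := by
  induction k generalizing b with
  | zero => simp [compareRegs, countdown, Circuit.act]
  | succ k ih =>
    have hbk : b (Q, k) = false := hb k (Nat.lt_succ_self k)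
    let b1 := (Gate.cnot (S, k) (outputReg, k)).act f b
    let b2 := (Gate.not (outputReg, k)).act f b1
    let b3 := (Gate.toffoli (outputReg, k) (Q, k + 1) (Q, k)).act f b2
    have hact : Circuit.act f (compareRegs S Q (k + 1)) b =
        Circuit.act f (compareRegs S Q k) b3 := rfl
    have h3 : ∀ r i, b3 (r, i) = if r = Q ∧ i = k then
        (b (Q, k + 1) && !(Bool.xor (b (outputReg, k)) (b (S, k))))
        else if r = outputReg ∧ i = k then !(Bool.xor (b (outputReg, k)) (b (S, k)))
        else b (r, i) := by
      intro r i
      simp only [b3, b2, b1, Gate.act, Function.update_apply, Prod.mk.injEq, hS, hQ, hQ.symm,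
        hbk, and_true, if_false, or_false, Nat.succ_ne_self, and_false, Bool.false_xor,
        if_true, Bool.and_comm]
      split_ifs <;> rfl
    rw [hact, ih b3 ?_, h3, if_pos ⟨rfl, rfl⟩]
    · have hlt : (∀ i < k + 1, b (S, i) = b (outputReg, i)) ↔
          b (S, k) = b (outputReg, k) ∧ ∀ i < k, b (S, i) = b (outputReg, i) := by
        constructor
        · exact fun h => ⟨h k (by omega), fun i hi => h i (by omega)⟩
        · rintro ⟨h1, h2⟩ i hi
          rcases Nat.lt_succ_iff_lt_or_eq.1 hi with h | rfl
          exacts [h2 i h, h1]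
      -- Overwriting output bit `k` does no harm, as the remaining comparisons read only lower
      -- positions.
      have hrest : (∀ i < k, b3 (S, i) = b3 (outputReg, i)) ↔
          ∀ i < k, b (S, i) = b (outputReg, i) := by
        refine forall₂_congr fun i hi => ?_
        simp [h3, hSQ, hS, hi.ne]
      rw [hlt, hrest, ← and_assoc]
      refine and_congr_left fun _ => ?_
      cases b (Q, k + 1) <;> cases b (S, k) <;> cases b (outputReg, k) <;> simp
    · intro i hi
      simp [h3, hQ, hi.ne, hb i (by omega)]

/-- Query the oracle at the message in register `B`, and leave in the first qubit of the output
register whether the output register holds the answer. -/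
def checkGuess (B m : ℕ) : Circuit :=
  [.query B (B + 1), .not (B + 2, m)] ++ (compareRegs (B + 1) (B + 2) m ++
    [.cnot (B + 2, 0) (outputReg, 0), .cnot (outputReg, 0) (B + 2, 0),
      .cnot (B + 2, 0) (outputReg, 0)])

theorem checkGuess_classical (B m : ℕ) : ∀ g ∈ checkGuess B m, Gate.Classical g := by
  have h : ∀ k, ∀ g ∈ compareRegs (B + 1) (B + 2) k, Gate.Classical g := by
    intro k
    induction k with
    | zero => simp [compareRegs, countdown]
    | succ k ih =>
      intro g hg
      rcases List.mem_append.1 hg with h | h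
      · simp only [List.mem_cons, List.not_mem_nil, or_false] at h
        rcases h with rfl | rfl | rfl <;> trivial
      · exact ih g h
  intro g hg
  simp only [checkGuess, List.mem_append, List.mem_cons, List.not_mem_nil, or_false] at hg
  rcases hg with (rfl | rfl) | hg | rfl | rfl | rfl <;> first | trivial | exact h m g hg

theorem readReg_xorReg_of_blank {R : ℕ} (x : Bits n) {b : Basis}
    (hb : ∀ i, b (R, i) = false) : readReg n R (xorReg R x b) = x := by
  funext i
  simp [readReg, xorReg, hb]

theorem act_checkGuess {B : ℕ} (hB : outputReg < B) (x : Bits n) {b : Basis}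
    (hb : BlankFrom B b) :
    Circuit.act f (checkGuess B m) (xorReg B x b) (outputReg, 0) =
      decide (f x = readReg m outputReg b) := by
  let b1 := (Gate.query B (B + 1)).act f (xorReg B x b)
  let b2 := (Gate.not (B + 2, m)).act f b1
  let b3 := Circuit.act f (compareRegs (B + 1) (B + 2) m) b2
  have hact : Circuit.act f (checkGuess B m) (xorReg B x b) (outputReg, 0) =
      b3 (B + 2, 0) := by
    -- The three final CNOTs swap the verdict in `(B + 2, 0)` with the first output qubit, where
    -- `acceptProb` reads it.
    have : Circuit.act f (checkGuess B m) (xorReg B x b) =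
        (Gate.cnot (B + 2, 0) (outputReg, 0)).act f
          ((Gate.cnot (outputReg, 0) (B + 2, 0)).act f
            ((Gate.cnot (B + 2, 0) (outputReg, 0)).act f b3)) := by
      rw [checkGuess, Circuit.act_append, Circuit.act_append]
      rfl
    have h1 : B + 2 ≠ outputReg := by omega
    rw [this]
    simp only [Gate.act, Function.update_apply, Prod.mk.injEq, h1, h1.symm, and_true, if_false,
      if_true]
    cases b3 (outputReg, 0) <;> cases b3 (B + 2, 0) <;> rfl
  have hb1 : b1 = xorReg (B + 1) (f x) (xorReg B x b) := by
    simp only [b1, Gate.act]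
    rw [if_neg (by omega), readReg_xorReg_of_blank x fun i => hb (B, i) le_rfl]
  have hb2 : ∀ r i, r ≠ B + 2 → b2 (r, i) = b1 (r, i) := by
    intro r i h
    simp [b2, Gate.act, h]
  have hb1Q : ∀ i, b1 (B + 2, i) = false := by
    intro i
    rw [hb1, xorReg_of_ne (by simp), xorReg_of_ne (by simp), hb _ (by simp)]
  have hQ : ∀ i < m, b2 (B + 2, i) = false := by
    intro i hi
    simp [b2, Gate.act, hi.ne, hb1Q]
  -- The initial NOT supplies the value of the empty conjunction.
  have hQm : b2 (B + 2, m) = true := by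
    simp [b2, Gate.act, hb1Q]
  have hO : ∀ i, b2 (outputReg, i) = b (outputReg, i) := by
    intro i
    rw [hb2 _ _ (by omega), hb1, xorReg_of_ne (by simp only; omega),
      xorReg_of_ne (by simp only; omega)]
  have hS : ∀ i : Fin m, b2 (B + 1, i) = f x i := by
    intro i
    rw [hb2 _ _ (by omega), hb1]
    simp [xorReg, hb (B + 1, i) (by simp)]
  have hiff := act_compareRegs f (S := B + 1) (Q := B + 2) (by omega) (by omega) (by omega) b2 hQ
  rw [hact, Bool.eq_iff_iff, decide_eq_true_iff]
  refine hiff.trans ?_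
  constructor
  · rintro ⟨-, h⟩
    funext i
    rw [← hS i, h i i.2, hO]
    rfl
  · intro h
    refine ⟨hQm, fun i hi => ?_⟩
    rw [hO, hS ⟨i, hi⟩, h]
    rfl

/-! ## The distinguisher plays the unforgeability game -/

/-- Probability that the guess for a tag of the challenge `x` is `f x`. -/
noncomputable def guessProb (L G : Circuit) (x : Bits n) : ℝ :=
  measureProb (Circuit.run f G (permute (xorReg challengeReg x) (Circuit.run f L zeroState)))
    fun b => decide (f x = readReg m outputReg b)

/-- The circuit of the distinguisher: run the learning phase, choose a challenge, run the guess
phase and check the guess. -/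
def gameCircuit (L G : Circuit) (B n m : ℕ) : Circuit :=
  L ++ (prepareChallenge B n ++ (G ++ checkGuess B m))

/-- Deferred measurement: register `B` still contains `x` at the end, so the branches are orthogonal
and their probabilities add without interference. The factor is the squared amplitude of a branch.
-/
theorem measureProb_gameCircuit {B : ℕ} (hB : outputReg < B) {L G : Circuit}
    (hL : L.RegsLt B) (hG : G.RegsLt B) :
    measureProb (Circuit.run f (gameCircuit L G B n m) zeroState) (fun b => b (outputReg, 0)) =
      (1 / 2 : ℝ) ^ n * ∑ x, guessProb f L G x := by
  have hB' : challengeReg < B := lt_trans (by decide) hB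
  have hψ := Circuit.run_mem_blankStates f hL (zeroState_mem_blankStates B)
  set ψ := Circuit.run f L zeroState with hψdef
  have hφ : ∀ x : Bits n, Circuit.run f G (permute (xorReg challengeReg x) ψ) ∈ blankStates B :=
    fun x => Circuit.run_mem_blankStates f hG (permute_xorReg_mem_blankStates hB' x hψ)
  have hstate : Circuit.run f G (Circuit.run f (prepareChallenge B n) ψ) =
      (((Real.sqrt 2 : ℝ) : ℂ)⁻¹) ^ n • ∑ x : Bits n, permute (xorReg B x)
        (Circuit.run f G (permute (xorReg challengeReg x) ψ)) := by
    rw [run_prepareChallenge f hB' hψ, ← Circuit.runLin_apply, map_smul, map_sum]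
    simp only [Circuit.runLin_apply, Circuit.run_permute_xorReg f le_rfl hG]
  rw [gameCircuit, Circuit.run_append, Circuit.run_append, Circuit.run_append, hstate,
    Circuit.run_of_classical f (checkGuess_classical B m),
    measureProb_permute (Circuit.act_injective f _), measureProb_smul, norm_pow, ← pow_mul,
    mul_comm n 2, pow_mul, norm_sqrt_two_inv_sq, measureProb_sum_of_label _ (readReg n B)]
  · congr 1
    refine Finset.sum_congr rfl fun x _ => ?_
    rw [measureProb_permute (xorReg_injective B x)]
    exact measureProb_congr fun b hb => act_checkGuess f hB x (mem_blankStates.1 (hφ x) b hb)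
  · intro x b hb
    obtain ⟨b', hb', rfl⟩ := mem_support_permute hb
    exact readReg_xorReg_of_blank x fun i => mem_blankStates.1 (hφ x) b' hb' (B, i) le_rfl

/-! ## Guessing a value of a random function -/

/-- The true final state is the one of the modified run minus the propagated difference of the
learned states, and `|u + v| ^ 2 ≤ 2 |u| ^ 2 + 2 |v| ^ 2`. The event on the right still asks for the
old value `f x`, which the modified run never sees. -/
theorem guessProb_le_of_update {L G : Circuit} (hG : G.QueryFree) (x : Bits n) (y : Bits m) :
    guessProb f L G x ≤
      2 * measureProb (Circuit.run (Function.update f x y) G (permute (xorReg challengeReg x)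
          (Circuit.run (Function.update f x y) L zeroState)))
        (fun b => decide (f x = readReg m outputReg b)) +
      2 * normSq (Circuit.run (Function.update f x y) L zeroState -
        Circuit.run f L zeroState) := by
  set ψ := Circuit.run f L zeroState
  set φ := Circuit.run (Function.update f x y) L zeroState
  set E : Basis → Bool := fun b => decide (f x = readReg m outputReg b)
  have h1 : guessProb f L G x = measureProb (Circuit.run (Function.update f x y) G
      (permute (xorReg challengeReg x) φ) + -Circuit.run (Function.update f x y) G
      (permute (xorReg challengeReg x) (φ - ψ))) E := by
    rw [map_sub, Circuit.run_sub, guessProb,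
      Circuit.run_of_queryFree f hG (Function.update f x y)]
    congr 1
    abel
  rw [h1]
  refine (measureProb_add_le _ _ E one_pos).trans ?_
  have h2 := measureProb_le_normSq (-Circuit.run (Function.update f x y) G
      (permute (xorReg challengeReg x) (φ - ψ))) E
  rw [normSq_neg, normSq_run, normSq_permute (xorReg_injective _ x)] at h2
  have h3 : (1 : ℝ) + 1 = 2 := one_add_one_eq_two
  rw [inv_one, h3]
  linarith

/-- Exchanging the value of a function at a point with a spare value. -/
def swapValue (x : Bits n) (p : (Bits n → Bits m) × Bits m) : (Bits n → Bits m) × Bits m :=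
  (Function.update p.1 x p.2, p.1 x)

theorem swapValue_involutive (x : Bits n) :
    Function.Involutive (swapValue (m := m) x) := by
  rintro ⟨f, y⟩
  simp [swapValue]

theorem card_bits (k : ℕ) : Fintype.card (Bits k) = 2 ^ k := by
  simp [Bits]

theorem sum_guessProb_le {L G : Circuit} (hG : G.QueryFree) :
    ((1 / 2 : ℝ) ^ n * (∑ f : Bits n → Bits m, ∑ x, guessProb f L G x)) ≤
      (2 * (1 / 2 : ℝ) ^ m + 8 * (L.length : ℝ) ^ 2 * (1 / 2 : ℝ) ^ n) *
        (Fintype.card (Bits n → Bits m) : ℝ) := by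
  set N : ℝ := (Fintype.card (Bits n → Bits m) : ℝ) with hN
  let W : Bits n → (Bits n → Bits m) → Bits m → ℝ := fun x f y =>
    measureProb (Circuit.run f G (permute (xorReg challengeReg x) (Circuit.run f L zeroState)))
      (fun b => decide (y = readReg m outputReg b))
  let D : (Bits n → Bits m) → Bits m → Bits n → ℝ := fun f y x =>
    normSq (Circuit.run (Function.update f x y) L zeroState - Circuit.run f L zeroState)
  -- Swapping turns "run with the modified function, guess the old value" into "run with `f`, guess
  -- an unrelated `y`". For each `f` the probabilities of the guesses `y` add up to one, so the sum
  -- is `N` and not `N * 2 ^ m`.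
  have hW : ∀ x, ∑ p : (Bits n → Bits m) × Bits m,
      W x (Function.update p.1 x p.2) (p.1 x) = N := by
    intro x
    have h := Equiv.sum_comp (Function.Involutive.toPerm _ (swapValue_involutive (m := m) x))
      fun p : (Bits n → Bits m) × Bits m => W x p.1 p.2
    refine h.trans ?_
    rw [Fintype.sum_prod_type]
    simp only [W, sum_measureProb_fiber, normSq_run, normSq_permute (xorReg_injective _ _),
      normSq_zeroState, Finset.sum_const, Finset.card_univ, nsmul_eq_mul, mul_one, hN]
  have hD : ∀ f y, ∑ x, D f y x ≤ 4 * (L.length : ℝ) ^ 2 := by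
    intro f y
    have h := sum_normSq_run_sub_le f L (fun x => Function.update f x y)
      (fun x z hz => Function.update_of_ne hz _ _) zeroState
    rwa [normSq_zeroState, mul_one] at h
  have hle : (2 : ℝ) ^ m * ∑ f : Bits n → Bits m, ∑ x, guessProb f L G x ≤
      2 * ((2 : ℝ) ^ n * N) + 2 * ((N * 2 ^ m) * (4 * (L.length : ℝ) ^ 2)) := by
    -- The factor `2 ^ m` introduces the replacement value `y` as a dummy summation variable.
    calc (2 : ℝ) ^ m * ∑ f : Bits n → Bits m, ∑ x, guessProb f L G x
        = ∑ f : Bits n → Bits m, ∑ y : Bits m, ∑ x, guessProb f L G x := by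
          rw [Finset.mul_sum]
          refine Finset.sum_congr rfl fun f _ => ?_
          rw [Finset.sum_const, Finset.card_univ, card_bits, nsmul_eq_mul]
          push_cast
          rfl
      _ ≤ ∑ f : Bits n → Bits m, ∑ y : Bits m, ∑ x,
            (2 * W x (Function.update f x y) (f x) + 2 * D f y x) := by
          gcongr with f _ y _ x _
          exact guessProb_le_of_update f hG x y
      _ = 2 * (∑ x, ∑ p : (Bits n → Bits m) × Bits m, W x (Function.update p.1 x p.2) (p.1 x)) +
            2 * ∑ f : Bits n → Bits m, ∑ y : Bits m, ∑ x, D f y x := by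
          simp only [Finset.sum_add_distrib, ← Finset.mul_sum]
          congr 2
          rw [← Fintype.sum_prod_type' (f := fun f y =>
            ∑ x, W x (Function.update f x y) (f x)), Finset.sum_comm]
      _ ≤ 2 * (∑ _x : Bits n, N) +
            2 * ∑ f : Bits n → Bits m, ∑ y : Bits m, 4 * (L.length : ℝ) ^ 2 := by
          simp only [hW]
          gcongr with f _ y _
          exact hD f y
      _ = _ := by
          simp only [Finset.sum_const, Finset.card_univ, card_bits, nsmul_eq_mul, ← hN]
          push_cast
          ring
  have h2 : ∀ k : ℕ, (1 / 2 : ℝ) ^ k * 2 ^ k = 1 := fun k => by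
    rw [← mul_pow]; norm_num
  calc _ = ((1 / 2 : ℝ) ^ n * (1 / 2 : ℝ) ^ m) *
        ((2 : ℝ) ^ m * ∑ f : Bits n → Bits m, ∑ x, guessProb f L G x) := by
        linear_combination (-((1 / 2 : ℝ) ^ n * ∑ f : Bits n → Bits m, ∑ x, guessProb f L G x)) *
          h2 m
    _ ≤ ((1 / 2 : ℝ) ^ n * (1 / 2 : ℝ) ^ m) *
        (2 * ((2 : ℝ) ^ n * N) + 2 * ((N * 2 ^ m) * (4 * (L.length : ℝ) ^ 2))) := by gcongr
    _ = _ := by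
        linear_combination 2 * N * (1 / 2 : ℝ) ^ m * h2 n +
          8 * N * (L.length : ℝ) ^ 2 * (1 / 2 : ℝ) ^ n * h2 m

end circuits

/-! ## Programs -/

/-- All registers of the gates emitted by the program are below `B`. -/
def Prog.RegsLt (B : ℕ) : Prog → Prop
  | .emit g => g.RegsLt B
  | .seq p q => p.RegsLt B ∧ q.RegsLt B
  | .ifz _ p q => p.RegsLt B ∧ q.RegsLt B
  | .while _ p => p.RegsLt B
  | _ => True

theorem Gate.RegsLt.mono {B B' : ℕ} (h : B ≤ B') {g : Gate Wire} (hg : g.RegsLt B) :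
    g.RegsLt B' := by
  cases g <;> simp only [Gate.RegsLt] at hg ⊢ <;> omega

theorem Prog.RegsLt.mono {B B' : ℕ} (h : B ≤ B') {p : Prog} (hp : p.RegsLt B) :
    p.RegsLt B' := by
  induction p with
  | emit g => exact Gate.RegsLt.mono h hp
  | seq p q ihp ihq => exact ⟨ihp hp.1, ihq hp.2⟩
  | ifz x p q ihp ihq => exact ⟨ihp hp.1, ihq hp.2⟩
  | _ => first | trivial | (rename_i ih; exact ih hp)

/-- Register numbers are literals of the program text; only positions depend on the memory. Hence
one bound works for all security parameters, and the registers from `B` on are free for the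
distinguisher. -/
theorem Prog.exists_regsLt (p : Prog) : ∃ B, p.RegsLt B := by
  induction p with
  | emit g =>
    cases g with
    | had w => exact ⟨w.1 + 1, Nat.lt_succ_self _⟩
    | phaseT w => exact ⟨w.1 + 1, Nat.lt_succ_self _⟩
    | not w => exact ⟨w.1 + 1, Nat.lt_succ_self _⟩
    | cnot c t =>
      refine ⟨c.1 + t.1 + 1, ?_⟩
      simp only [Prog.RegsLt, Gate.RegsLt]
      omega
    | toffoli c d t =>
      refine ⟨c.1 + d.1 + t.1 + 1, ?_⟩
      simp only [Prog.RegsLt, Gate.RegsLt]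
      omega
    | query r s =>
      refine ⟨r + s + 1, ?_⟩
      simp only [Prog.RegsLt, Gate.RegsLt]
      omega
  | seq p q ihp ihq =>
    obtain ⟨B, hB⟩ := ihp
    obtain ⟨B', hB'⟩ := ihq
    exact ⟨max B B', hB.mono (le_max_left _ _), hB'.mono (le_max_right _ _)⟩
  | ifz x p q ihp ihq =>
    obtain ⟨B, hB⟩ := ihp
    obtain ⟨B', hB'⟩ := ihq
    exact ⟨max B B', hB.mono (le_max_left _ _), hB'.mono (le_max_right _ _)⟩
  | _ => first | exact ⟨0, trivial⟩ | assumption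

theorem Circuit.RegsLt.append {B : ℕ} {C D : Circuit} (hC : C.RegsLt B) (hD : D.RegsLt B) :
    Circuit.RegsLt B (C ++ D) := fun g hg =>
  (List.mem_append.1 hg).elim (hC g) (hD g)

theorem Circuit.regsLt_nil (B : ℕ) : Circuit.RegsLt B [] := fun _ h => (List.not_mem_nil h).elim

theorem Runs.regsLt {B : ℕ} {p : Prog} {σ τ : Store} {C : Circuit} {t : ℕ}
    (h : Runs p σ τ C t) (hp : p.RegsLt B) : C.RegsLt B := by
  induction h with
  | const | add | sub | half | while_stop => exact Circuit.regsLt_nil B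
  | emit g σ =>
    intro g' hg'
    rw [List.mem_singleton.1 hg']
    cases g <;> exact hp
  | seq _ _ ih1 ih2 => exact (ih1 hp.1).append (ih2 hp.2)
  | ifz_zero _ _ ih => exact ih hp.1
  | ifz_pos _ _ ih => exact ih hp.2
  | while_step _ _ _ ih1 ih2 => exact (ih1 hp).append (ih2 hp)

/-- Each emitted gate costs a step, so polynomial time bounds the circuit length that enters the
hybrid argument. -/
theorem Runs.length_le {p : Prog} {σ τ : Store} {C : Circuit} {t : ℕ}
    (h : Runs p σ τ C t) : C.length ≤ t := by
  induction h with
  | seq _ _ ih1 ih2 => rw [List.length_append]; omega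
  | while_step _ _ _ ih1 ih2 => rw [List.length_append]; omega
  | ifz_zero _ _ ih => omega
  | ifz_pos _ _ ih => omega
  | _ => simp

/-- Rename the variables of a program. -/
def Prog.rename (ρ : ℕ → ℕ) : Prog → Prog
  | .const x c => .const (ρ x) c
  | .add x y z => .add (ρ x) (ρ y) (ρ z)
  | .sub x y z => .sub (ρ x) (ρ y) (ρ z)
  | .half x y => .half (ρ x) (ρ y)
  | .emit g => .emit (g.map fun a => (a.1, ρ a.2))
  | .seq p q => .seq (p.rename ρ) (q.rename ρ)
  | .ifz x p q => .ifz (ρ x) (p.rename ρ) (q.rename ρ)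
  | .while x p => .while (ρ x) (p.rename ρ)

theorem update_comp_rename {ρ : ℕ → ℕ} (hρ : Function.Injective ρ) (σ : Store) (x a : ℕ) :
    (fun v => Function.update σ (ρ x) a (ρ v)) = Function.update (fun v => σ (ρ v)) x a :=
  Function.update_comp_eq_of_injective σ hρ x a

theorem Gate.map_map {U V W : Type} (j : V → W) (i : U → V) (g : Gate U) :
    (g.map i).map j = g.map fun a => j (i a) := by
  cases g <;> rfl

/-- A program with renamed variables runs alike and does not touch the other variables. -/
theorem Runs.rename {ρ : ℕ → ℕ} (hρ : Function.Injective ρ) {p : Prog} {σ τ : Store}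
    {C : Circuit} {t : ℕ} (h : Runs p σ τ C t) :
    ∀ σ' : Store, (fun v => σ' (ρ v)) = σ → ∃ τ' : Store, Runs (p.rename ρ) σ' τ' C t ∧
      (fun v => τ' (ρ v)) = τ ∧ ∀ v, v ∉ Set.range ρ → τ' v = σ' v := by
  have hne : ∀ {x v : ℕ}, v ∉ Set.range ρ → v ≠ ρ x := fun hv h => hv ⟨_, h.symm⟩
  induction h with
  | const x c σ =>
    rintro σ' rfl
    exact ⟨_, .const _ _ _, update_comp_rename hρ _ _ _,
      fun v hv => Function.update_of_ne (hne hv) _ _⟩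
  | add x y z σ =>
    rintro σ' rfl
    exact ⟨_, .add _ _ _ _, update_comp_rename hρ _ _ _,
      fun v hv => Function.update_of_ne (hne hv) _ _⟩
  | sub x y z σ =>
    rintro σ' rfl
    exact ⟨_, .sub _ _ _ _, update_comp_rename hρ _ _ _,
      fun v hv => Function.update_of_ne (hne hv) _ _⟩
  | half x y σ =>
    rintro σ' rfl
    exact ⟨_, .half _ _ _, update_comp_rename hρ _ _ _,
      fun v hv => Function.update_of_ne (hne hv) _ _⟩
  | emit g σ =>
    rintro σ' rfl
    refine ⟨σ', ?_, rfl, fun _ _ => rfl⟩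
    have h := Runs.emit (g.map fun a => (a.1, ρ a.2)) σ'
    rwa [Gate.map_map] at h
  | seq _ _ ih1 ih2 =>
    intro σ' hσ
    obtain ⟨τ', h1, hτ, hf1⟩ := ih1 σ' hσ
    obtain ⟨υ', h2, hυ, hf2⟩ := ih2 τ' hτ
    exact ⟨υ', h1.seq h2, hυ, fun v hv => (hf2 v hv).trans (hf1 v hv)⟩
  | ifz_zero h0 _ ih =>
    rintro σ' rfl
    obtain ⟨τ', h1, hτ, hf1⟩ := ih σ' rfl
    exact ⟨τ', .ifz_zero h0 h1, hτ, hf1⟩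
  | ifz_pos h0 _ ih =>
    rintro σ' rfl
    obtain ⟨τ', h1, hτ, hf1⟩ := ih σ' rfl
    exact ⟨τ', .ifz_pos h0 h1, hτ, hf1⟩
  | while_stop h0 =>
    rintro σ' rfl
    exact ⟨σ', Runs.while_stop h0, rfl, fun _ _ => rfl⟩
  | while_step h0 _ _ ih1 ih2 =>
    rintro σ' rfl
    obtain ⟨τ', h1, hτ, hf1⟩ := ih1 σ' rfl
    obtain ⟨υ', h2, hυ, hf2⟩ := ih2 τ' hτ
    exact ⟨υ', .while_step h0 h1 h2, hυ, fun v hv => (hf2 v hv).trans (hf1 v hv)⟩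

/-- Run `body` with the values `σ x - 1`, …, `0` in variable `11`, provided that variable `14`
holds `1` and variable `8` holds `0`. -/
def Prog.countdown (x : ℕ) (body : Prog) : Prog :=
  .while x (.seq (.sub 11 x 14) (.seq body (.add x 11 8)))

/-- During a round variable `11` holds the index `k` while `x` still holds `k + 1`, so the body can
address both positions. A round costs the body plus a test, a subtraction and an addition; the final
`1` is the failing test. -/
theorem Runs.countdown {x : ℕ} (hx : x ≠ 11 ∧ x ≠ 14 ∧ x ≠ 8) {body : Prog} {C : ℕ → Circuit}
    {s : ℕ} (hbody : ∀ (σ : Store) (k : ℕ), σ x = k + 1 → σ 11 = k → Runs body σ σ (C k) s) :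
    ∀ (k : ℕ) (σ : Store), σ x = k → σ 14 = 1 → σ 8 = 0 →
      ∃ τ : Store, Runs (Prog.countdown x body) σ τ (QUnforge.countdown C k)
        ((s + 3) * k + 1) ∧ ∀ v, v ≠ x → v ≠ 11 → τ v = σ v := by
  intro k
  induction k with
  | zero =>
    intro σ h0 _ _
    refine ⟨σ, ?_, fun _ _ _ => rfl⟩
    simpa [Prog.countdown, QUnforge.countdown] using Runs.while_stop h0
  | succ k ih =>
    intro σ hk h14 h8
    let σ1 := Function.update σ 11 (σ x - σ 14)
    have e11 : σ1 11 = k := by simp [σ1, hk, h14]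
    have ex : σ1 x = k + 1 := by simp [σ1, hx.1, hk]
    have e8 : σ1 8 = 0 := by simp [σ1, h8]
    let σ2 := Function.update σ1 x (σ1 11 + σ1 8)
    have hσ2 : ∀ v, v ≠ x → v ≠ 11 → σ2 v = σ v := fun v h h' => by simp [σ2, σ1, h, h']
    obtain ⟨τ, hτ, hfr⟩ := ih σ2 (by simp [σ2, e11, e8])
      (by rw [hσ2 14 hx.2.1.symm (by decide), h14]) (by rw [hσ2 8 hx.2.2.symm (by decide), h8])
    refine ⟨τ, ?_, fun v h h' => (hfr v h h').trans (hσ2 v h h')⟩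
    have h1 := (Runs.sub 11 x 14 σ).seq ((hbody σ1 k ex e11).seq (Runs.add x 11 8 σ1))
    have h2 := Runs.while_step (x := x) (by omega) h1 hτ
    have ht : 1 + (s + 1) + ((s + 3) * k + 1) + 1 = (s + 3) * (k + 1) + 1 := by ring
    rw [ht, List.nil_append, List.append_nil] at h2
    exact h2

/-- Program for `prepareChallenge`, the message length being in variable `5`. -/
def prepareProg (B : ℕ) : Prog :=
  Prog.countdown 5 (.seq (.emit (.had (B, 11))) (.emit (.cnot (B, 11) (challengeReg, 11))))

theorem runs_prepareProg (B k : ℕ) (σ : Store) (h5 : σ 5 = k) (h14 : σ 14 = 1) (h8 : σ 8 = 0) :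
    ∃ τ : Store, Runs (prepareProg B) σ τ (prepareChallenge B k) (5 * k + 1) ∧
      ∀ v, v ≠ 5 → v ≠ 11 → τ v = σ v := by
  refine Runs.countdown (s := 2) (by decide) ?_ k σ h5 h14 h8
  intro σ k _ h11
  have h := (Runs.emit (.had (B, 11)) σ).seq (Runs.emit (.cnot (B, 11) (challengeReg, 11)) σ)
  simpa only [Gate.map, h11, List.singleton_append] using h

/-- Program for `checkGuess`, the tag length being in variable `2`. -/
def checkProg (B : ℕ) : Prog :=
  .seq (.seq (.emit (.query B (B + 1))) (.emit (.not (B + 2, 2))))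
    (.seq
      (Prog.countdown 2 (.seq (.emit (.cnot (B + 1, 11) (outputReg, 11)))
        (.seq (.emit (.not (outputReg, 11)))
          (.emit (.toffoli (outputReg, 11) (B + 2, 2) (B + 2, 11))))))
      (.seq (.emit (.cnot (B + 2, 8) (outputReg, 8)))
        (.seq (.emit (.cnot (outputReg, 8) (B + 2, 8)))
          (.emit (.cnot (B + 2, 8) (outputReg, 8))))))

/-- Variable `2` has two uses: before the loop it addresses the qubit that starts the conjunction,
inside the loop the previous partial conjunction. Variable `8` addresses position `0`. -/
theorem runs_checkProg (B k : ℕ) (σ : Store) (h2 : σ 2 = k) (h14 : σ 14 = 1) (h8 : σ 8 = 0) :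
    ∃ τ : Store, Runs (checkProg B) σ τ (checkGuess B k) (6 * k + 6) := by
  obtain ⟨τ, hτ, hfr⟩ := Runs.countdown (x := 2) (s := 3)
    (C := fun i => [.cnot (B + 1, i) (outputReg, i), .not (outputReg, i),
      .toffoli (outputReg, i) (B + 2, i + 1) (B + 2, i)])
    (body := .seq (.emit (.cnot (B + 1, 11) (outputReg, 11)))
        (.seq (.emit (.not (outputReg, 11)))
          (.emit (.toffoli (outputReg, 11) (B + 2, 2) (B + 2, 11))))) (by decide)
    (fun σ k hk h11 => by
      have h := (Runs.emit (.cnot (B + 1, 11) (outputReg, 11)) σ).seq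
        ((Runs.emit (.not (outputReg, 11)) σ).seq
          (Runs.emit (.toffoli (outputReg, 11) (B + 2, 2) (B + 2, 11)) σ))
      simpa only [Gate.map, h11, hk, List.singleton_append] using h) k σ h2 h14 h8
  have h8' : τ 8 = 0 := by rw [hfr 8 (by decide) (by decide), h8]
  refine ⟨τ, ?_⟩
  have h := ((Runs.emit (.query B (B + 1)) σ).seq (Runs.emit (.not (B + 2, 2)) σ)).seq
    (hτ.seq ((Runs.emit (.cnot (B + 2, 8) (outputReg, 8)) τ).seq
      ((Runs.emit (.cnot (outputReg, 8) (B + 2, 8)) τ).seq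
        (Runs.emit (.cnot (B + 2, 8) (outputReg, 8)) τ))))
  simp only [Gate.map, h8', h2, List.singleton_append] at h
  have ht : 1 + 1 + ((3 + 3) * k + 1 + (1 + (1 + 1))) = 6 * k + 6 := by ring
  rw [ht] at h
  exact h

/-- Distribute the inputs to the variables of the learning phase (multiples of `3`), of the guess
phase (`1` mod `3`) and of the distinguisher itself (`2` mod `3`). -/
def initProg : Prog :=
  .seq (.add 3 1 8) (.seq (.add 4 1 8) (.seq (.add 5 1 8) (.seq (.add 6 2 8) (.seq (.add 7 2 8)
    (.seq (.add 1 0 8) (.const 14 1))))))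

/-- Adding the zero in variable `8` makes copies. Variable `1` is overwritten only after the message
length has been read from it. -/
theorem runs_initProg (lam n m : ℕ) : ∃ τ : Store, Runs initProg (inputStore lam n m) τ [] 7 ∧
    (fun v => τ (3 * v)) = inputStore lam n m ∧ (fun v => τ (3 * v + 1)) = inputStore lam n m ∧
      τ 2 = m ∧ τ 5 = n ∧ τ 8 = 0 ∧ τ 14 = 1 := by
  refine ⟨_, (Runs.add 3 1 8 _).seq ((Runs.add 4 1 8 _).seq ((Runs.add 5 1 8 _).seq
    ((Runs.add 6 2 8 _).seq ((Runs.add 7 2 8 _).seq ((Runs.add 1 0 8 _).seq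
      (Runs.const 14 1 _)))))), ?_, ?_, ?_, ?_, ?_, ?_⟩
  · funext v
    rcases v with _ | _ | _ | v
    · simp [inputStore]
    · simp [inputStore]
    · simp [inputStore]
    · simp only [Function.update_apply, inputStore]
      repeat rw [if_neg (by omega)]
  · funext v
    rcases v with _ | _ | _ | v
    · simp [inputStore]
    · simp [inputStore]
    · simp [inputStore]
    · simp only [Function.update_apply, inputStore]
      repeat rw [if_neg (by omega)]
  all_goals simp [inputStore]

/-- Program of the distinguisher: play the unforgeability game with the oracle as the secret
function. -/
def gameProg (p q : Prog) (B : ℕ) : Prog :=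
  .seq initProg (.seq (p.rename fun v => 3 * v) (.seq (prepareProg B)
    (.seq (q.rename fun v => 3 * v + 1) (checkProg B))))

/-- The three phases use disjoint residue classes of variables mod `3`, so the guess program starts
from a fresh copy of the inputs, and the constants and the tag length survive until the check. -/
theorem runs_gameProg {p q : Prog} {lam n m : ℕ} {τ₁ τ₂ : Store} {L G : Circuit} {s t : ℕ}
    (hp : Runs p (inputStore lam n m) τ₁ L s) (hq : Runs q (inputStore lam n m) τ₂ G t) (B : ℕ) :
    ∃ τ : Store, Runs (gameProg p q B) (inputStore lam n m) τ (gameCircuit L G B n m)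
      (s + t + 5 * n + 6 * m + 14) := by
  obtain ⟨σ1, h1, hL, hG, h2, h5, h8, h14⟩ := runs_initProg lam n m
  have inj0 : Function.Injective fun v : ℕ => 3 * v := fun a b h => by
    simp only at h; omega
  have inj1 : Function.Injective fun v : ℕ => 3 * v + 1 := fun a b h => by
    simp only at h; omega
  obtain ⟨σ2, hr2, -, hf2⟩ := hp.rename inj0 σ1 hL
  have hf2' : ∀ v, v % 3 ≠ 0 → σ2 v = σ1 v := fun v hv =>
    hf2 v (by rintro ⟨u, rfl⟩; simp only at hv; omega)
  obtain ⟨σ3, hr3, hf3⟩ := runs_prepareProg B n σ2 (by rw [hf2' 5 (by decide), h5])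
    (by rw [hf2' 14 (by decide), h14]) (by rw [hf2' 8 (by decide), h8])
  have hG3 : (fun v => σ3 (3 * v + 1)) = inputStore lam n m := by
    rw [← hG]
    funext v
    rw [hf3 _ (by omega) (by omega), hf2' _ (by omega)]
  obtain ⟨σ4, hr4, -, hf4⟩ := hq.rename inj1 σ3 hG3
  have hf4' : ∀ v, v % 3 = 2 → v ≠ 5 → v ≠ 11 → σ4 v = σ1 v := fun v hv h h' => by
    rw [hf4 v (by rintro ⟨u, rfl⟩; simp only at hv; omega), hf3 v h h', hf2' v (by omega)]
  obtain ⟨σ5, hr5⟩ := runs_checkProg B m σ4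
    (by rw [hf4' 2 (by decide) (by decide) (by decide), h2])
    (by rw [hf4' 14 (by decide) (by decide) (by decide), h14])
    (by rw [hf4' 8 (by decide) (by decide) (by decide), h8])
  refine ⟨σ5, ?_⟩
  have h := h1.seq (hr2.seq (hr3.seq (hr4.seq hr5)))
  have ht : 7 + (s + (5 * n + 1 + (t + (6 * m + 6)))) = s + t + 5 * n + 6 * m + 14 := by ring
  rw [ht, List.nil_append] at h
  exact h

/-! ## The distinguisher as an algorithm -/

section family

variable {n m : ℕ → ℕ}

theorem QPTAlgorithm.regsLt (A : QPTAlgorithm n m) {B : ℕ} (hB : A.prog.RegsLt B) (lam : ℕ) :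
    (A.circuit lam).RegsLt B := by
  obtain ⟨P, hP⟩ := A.polyTime
  obtain ⟨τ, t, -, h⟩ := hP lam
  exact h.regsLt hB

theorem QPTAlgorithm.exists_length_le (A : QPTAlgorithm n m) :
    ∃ P : Polynomial ℕ, ∀ lam, (A.circuit lam).length ≤ P.eval lam := by
  obtain ⟨P, hP⟩ := A.polyTime
  refine ⟨P, fun lam => ?_⟩
  obtain ⟨τ, t, ht, h⟩ := hP lam
  exact h.length_le.trans ht

/-- The oracle algorithm that plays the unforgeability game against the adversary `A`, with the
oracle in the role of the secret function, and outputs whether `A` wins. -/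
def UniAdversary.distinguisher (A : UniAdversary n m)
    (hn : ∃ P : Polynomial ℕ, ∀ lam, n lam ≤ P.eval lam)
    (hm : ∃ P : Polynomial ℕ, ∀ lam, m lam ≤ P.eval lam) (B : ℕ) : QPTAlgorithm n m where
  prog := gameProg A.learn.prog A.guess.prog B
  circuit lam := gameCircuit (A.learn.circuit lam) (A.guess.circuit lam) B (n lam) (m lam)
  polyTime := by
    obtain ⟨N, hN⟩ := hn
    obtain ⟨M, hM⟩ := hm
    obtain ⟨P, hP⟩ := A.learn.polyTime
    obtain ⟨Q, hQ⟩ := A.guess.polyTime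
    refine ⟨P + Q + 5 * N + 6 * M + 14, fun lam => ?_⟩
    obtain ⟨τ₁, s, hs, h1⟩ := hP lam
    obtain ⟨τ₂, t, ht, h2⟩ := hQ lam
    obtain ⟨τ, h⟩ := runs_gameProg h1 h2 B
    refine ⟨τ, _, ?_, h⟩
    have hn := hN lam
    have hm := hM lam
    simp only [Polynomial.eval_add, Polynomial.eval_mul, Polynomial.eval_ofNat]
    omega

theorem expect_uniform {α : Type} [Fintype α] [Nonempty α] (P : α → ℝ) :
    expect (PMF.uniformOfFintype α) P = (Fintype.card α : ℝ)⁻¹ * ∑ a, P a := by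
  simp [expect, tsum_fintype, Finset.mul_sum]

theorem expect_uniform_bits (k : ℕ) (P : Bits k → ℝ) :
    expect (PMF.uniformOfFintype (Bits k)) P = (1 / 2 : ℝ) ^ k * ∑ x, P x := by
  rw [expect_uniform, card_bits]
  push_cast
  rw [one_div, inv_pow]

/-- Valid for every oracle, hence applicable both to `F_k` and to a random function. -/
theorem UniAdversary.acceptProb_distinguisher (A : UniAdversary n m)
    (hn : ∃ P : Polynomial ℕ, ∀ lam, n lam ≤ P.eval lam)
    (hm : ∃ P : Polynomial ℕ, ∀ lam, m lam ≤ P.eval lam) {B : ℕ} (hB : outputReg < B)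
    (hL : A.learn.prog.RegsLt B) (hG : A.guess.prog.RegsLt B) (lam : ℕ)
    (f : Bits (n lam) → Bits (m lam)) :
    (A.distinguisher hn hm B).acceptProb lam f = expect (PMF.uniformOfFintype (Bits (n lam)))
      fun x => guessProb f (A.learn.circuit lam) (A.guess.circuit lam) x := by
  rw [expect_uniform_bits]
  exact measureProb_gameCircuit f hB (A.learn.regsLt hL lam) (A.guess.regsLt hG lam)

/-- An adversary hardly ever guesses the value of a uniformly random function at a random
point. -/
theorem UniAdversary.expect_guessProb_le (A : UniAdversary n m) (lam : ℕ) :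
    expect (PMF.uniformOfFintype (Bits (n lam) → Bits (m lam))) (fun f =>
      expect (PMF.uniformOfFintype (Bits (n lam))) fun x =>
        guessProb f (A.learn.circuit lam) (A.guess.circuit lam) x) ≤
      2 * (1 / 2 : ℝ) ^ m lam +
        8 * ((A.learn.circuit lam).length : ℝ) ^ 2 * (1 / 2 : ℝ) ^ n lam := by
  have h := sum_guessProb_le (n := n lam) (m := m lam) (L := A.learn.circuit lam)
    (A.guess_queryFree lam)
  have hpos : (0 : ℝ) < Fintype.card (Bits (n lam) → Bits (m lam)) := by
    exact_mod_cast Fintype.card_pos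
  simp only [expect_uniform_bits]
  rw [expect_uniform, ← Finset.mul_sum, inv_mul_le_iff₀ hpos]
  linarith

end family

/-! ## Negligible functions -/

theorem Negligible.mono {f g : ℕ → ℝ} (hg : Negligible g) (h : ∀ lam, f lam ≤ g lam) :
    Negligible f := fun c => (hg c).mono fun lam hlam => (h lam).trans hlam

theorem Negligible.mul_pow {f : ℕ → ℝ} (hf : Negligible f) (d : ℕ) :
    Negligible fun lam => (lam : ℝ) ^ d * f lam := by
  intro c
  filter_upwards [hf (c + d), Filter.eventually_gt_atTop 0] with lam h hpos
  have hl : (0 : ℝ) < lam := by exact_mod_cast hpos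
  calc (lam : ℝ) ^ d * f lam ≤ (lam : ℝ) ^ d * (1 / (lam : ℝ) ^ (c + d)) := by gcongr
    _ = 1 / (lam : ℝ) ^ c := by
      rw [pow_add]
      field_simp

theorem Negligible.of_eventually_le {f g : ℕ → ℝ} (hg : Negligible g)
    (h : ∀ᶠ lam in Filter.atTop, f lam ≤ g lam) : Negligible f := fun c => by
  filter_upwards [hg c, h] with lam h1 h2 using h2.trans h1

theorem Negligible.add {f g : ℕ → ℝ} (hf : Negligible f) (hg : Negligible g) :
    Negligible fun lam => f lam + g lam := by
  intro c
  filter_upwards [hf (c + 1), hg (c + 1), Filter.eventually_ge_atTop 2] with lam h1 h2 hlam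
  have hl : (2 : ℝ) ≤ lam := by exact_mod_cast hlam
  have hl0 : (0 : ℝ) < lam := by linarith
  calc f lam + g lam ≤ 2 * (1 / (lam : ℝ) ^ (c + 1)) := by linarith
    _ ≤ lam * (1 / (lam : ℝ) ^ (c + 1)) := by gcongr
    _ = 1 / (lam : ℝ) ^ c := by
      rw [pow_succ]
      field_simp

/-- A polynomial is eventually dominated by a power. -/
theorem eventually_eval_le_pow (P : Polynomial ℕ) :
    ∃ d : ℕ, ∀ᶠ lam : ℕ in Filter.atTop, P.eval lam ≤ lam ^ d := by
  induction P using Polynomial.induction_on' with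
  | add p q hp hq =>
    obtain ⟨d, hd⟩ := hp
    obtain ⟨e, he⟩ := hq
    refine ⟨d + e + 1, ?_⟩
    filter_upwards [hd, he, Filter.eventually_ge_atTop 2] with lam h1 h2 hlam
    have e1 : lam ^ d ≤ lam ^ (d + e) := Nat.pow_le_pow_right (by omega) (by omega)
    have e2 : lam ^ e ≤ lam ^ (d + e) := Nat.pow_le_pow_right (by omega) (by omega)
    have e3 : lam ^ (d + e) * 2 ≤ lam ^ (d + e) * lam := Nat.mul_le_mul_left _ hlam
    rw [Polynomial.eval_add, pow_succ]
    omega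
  | monomial k a =>
    refine ⟨k + 1, ?_⟩
    filter_upwards [Filter.eventually_ge_atTop a] with lam hlam
    rw [Polynomial.eval_monomial, pow_succ']
    exact Nat.mul_le_mul_right _ hlam

theorem Negligible.mul_poly {f : ℕ → ℝ} (hf : Negligible f) (hf0 : ∀ lam, 0 ≤ f lam)
    (P : Polynomial ℕ) : Negligible fun lam => ((P.eval lam : ℕ) : ℝ) * f lam := by
  obtain ⟨d, hd⟩ := eventually_eval_le_pow P
  refine (hf.mul_pow d).of_eventually_le ?_
  filter_upwards [hd] with lam h
  have h' : ((P.eval lam : ℕ) : ℝ) ≤ (lam : ℝ) ^ d := by exact_mod_cast h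
  exact mul_le_mul_of_nonneg_right h' (hf0 lam)

end QUnforge

/-! ### Assembling the reduction -/

theorem mainTheorem10 (n m : ℕ → ℕ)
    (hn_poly : ∃ P : Polynomial ℕ, ∀ lam, n lam ≤ P.eval lam)
    (hm_poly : ∃ P : Polynomial ℕ, ∀ lam, m lam ≤ P.eval lam)
    (hn : QUnforge.Negligible fun lam => 1 / (2 : ℝ) ^ n lam)
    (hm : QUnforge.Negligible fun lam => 1 / (2 : ℝ) ^ m lam)
    (F : QUnforge.FunctionFamily n m) (hF : F.IsQPRF) :
    F.toPrimitive.IsQGUU := by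
  open QUnforge in
  intro A
  obtain ⟨B₁, hB₁⟩ := A.learn.prog.exists_regsLt
  obtain ⟨B₂, hB₂⟩ := A.guess.prog.exists_regsLt
  obtain ⟨P, hP⟩ := A.learn.exists_length_le
  -- Beyond all registers of both phases and beyond the output register, hence also beyond the
  -- challenge register.
  let B := B₁ + B₂ + outputReg + 1
  let D := A.distinguisher hn_poly hm_poly B
  have hacc := fun lam f => A.acceptProb_distinguisher hn_poly hm_poly (B := B) (by omega)
    (hB₁.mono (by omega)) (hB₂.mono (by omega)) lam f
  -- Distinguishing advantage plus the bound for a random function, with the circuit length replaced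
  -- by the polynomial `P`.
  have hbound : Negligible fun lam =>
      |expect (PMF.uniformOfFintype (F.Key lam)) (fun k => D.acceptProb lam (F.fn lam k)) -
        expect (PMF.uniformOfFintype (Bits (n lam) → Bits (m lam)))
          (fun f => D.acceptProb lam f)| +
      ((((2 : Polynomial ℕ).eval lam : ℕ) : ℝ) * (1 / (2 : ℝ) ^ m lam) +
        (((8 * P ^ 2).eval lam : ℕ) : ℝ) * (1 / (2 : ℝ) ^ n lam)) :=
    (hF D).add ((hm.mul_poly (fun lam => by positivity) 2).add
      (hn.mul_poly (fun lam => by positivity) (8 * P ^ 2)))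
  refine hbound.mono fun lam => ?_
  -- Verification compares with `F_k(x)`, so `winProbAt` unfolds to `guessProb` with oracle `F_k`.
  have hwin : A.winProb F.toPrimitive lam =
      expect (PMF.uniformOfFintype (F.Key lam)) fun k => D.acceptProb lam (F.fn lam k) :=
    congrArg (expect _) (funext fun k => (hacc lam (F.fn lam k)).symm)
  have hrand : expect (PMF.uniformOfFintype (Bits (n lam) → Bits (m lam)))
      (fun f => D.acceptProb lam f) ≤ _ :=
    (congrArg (expect _) (funext fun f => hacc lam f)).trans_le (A.expect_guessProb_le lam)
  have hlen : ((A.learn.circuit lam).length : ℝ) ^ 2 ≤ ((P.eval lam : ℕ) : ℝ) ^ 2 := by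
    gcongr
    exact_mod_cast hP lam
  have hlen' : 8 * ((A.learn.circuit lam).length : ℝ) ^ 2 * (1 / 2 : ℝ) ^ n lam ≤
      8 * ((P.eval lam : ℕ) : ℝ) ^ 2 * (1 / 2 : ℝ) ^ n lam := by gcongr
  rw [hwin]
  simp only [Polynomial.eval_mul, Polynomial.eval_pow, Polynomial.eval_ofNat, Nat.cast_mul,
    Nat.cast_pow, Nat.cast_ofNat, ← one_div_pow]
  linarith [le_abs_self (expect (PMF.uniformOfFintype (F.Key lam))
    (fun k => D.acceptProb lam (F.fn lam k)) -
      expect (PMF.uniformOfFintype (Bits (n lam) → Bits (m lam))) (fun f => D.acceptProb lam f))]
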